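/- Let $0\le k<n$ be integers, and let $\dim$ denote Hausdorff dimension. For $S\subset\mathbb{R}^n$, $x\in\mathbb{R}^n$, $r>0$ and $T\in SO(n)$ write $x+rT(S)=\{x+rT(s): s\in S\}$; its center is $x$. Suppose that one of the following holds: (a) $S$ is the $k$-skeleton (the union of all $k$-dimensional faces) of a nondegenerate $n$-dimensional cube in $\mathbb{R}^n$ centered at the origin; or, more generally, (b) $S\subset\mathbb{R}^n$ is a nonempty set with $\dim S=k$ that can be covered by countably many $k$-dimensional affine subspaces, none of which contains $0$. Then each of the following minima over Borel sets $A\subset\mathbb{R}^n$ is attained and has the stated value. 1. (Scaled copies.) The minimal dimension of a Borel set $A\subset\mathbb{R}^n$ such that for every $x\in\mathbb{R}^n$ there is $r>0$ with $x+rS\subset A$ is $n-1$. 2. (Scaled and rotated copies.) The minimal dimension of a Borel set $A\subset\mathbb{R}^n$ such that for every $x\in\mathbb{R}^n$ there are $r>0$ and $T\in SO(n)$ with $x+rT(S)\subset A$ is $k$. 3. (Rotated copies.) The minimal dimension of a Borel set $A\subset\mathbb{R}^n$ such that for every $x\in\mathbb{R}^n$ there is $T\in SO(n)$ with $x+T(S)\subset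 A$ is $k+1$. 4. (Rotated copies of every size.) The minimal dimension of a Borel set $A\subset\mathbb{R}^n$ such that for every $x\in\mathbb{R}^n$ and every $r>0$ there is $T\in SO(n)$ with $x+rT(S)\subset A$ is $k+1$. -/

import Mathlib

open MeasureTheory
open scoped ENNReal

/-- The `k`-skeleton of a convex polytope `P`: the union of its `k`-dimensional faces. The faces
of a polytope are the subsets on which some linear functional attains its maximum over `P`
(the zero functional gives `P` itself). -/
def skeleton {n : ℕ} (k : ℕ) (P : Set (EuclideanSpace ℝ (Fin n))) :
    Set (EuclideanSpace ℝ (Fin n)) :=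
  ⋃₀ {F | F.Nonempty ∧ IsExposed ℝ P F ∧ Module.finrank ℝ (vectorSpan ℝ F) = k}

/-- The closed `n`-dimensional cube centered at the origin with edges of length `2 * a` parallel
to the vectors of the orthonormal basis `b`. -/
def cube {n : ℕ} (b : OrthonormalBasis (Fin n) ℝ (EuclideanSpace ℝ (Fin n))) (a : ℝ) :
    Set (EuclideanSpace ℝ (Fin n)) :=
  {x | ∀ i, |inner ℝ (b i) x| ≤ a}

/-- `S` is the `k`-skeleton of some nondegenerate cube centered at the origin. -/
def IsCubeSkeleton {n : ℕ} (k : ℕ) (S : Set (EuclideanSpace ℝ (Fin n))) : Prop :=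
  ∃ (b : OrthonormalBasis (Fin n) ℝ (EuclideanSpace ℝ (Fin n))) (a : ℝ),
    0 < a ∧ S = skeleton k (cube b a)

/-- `S` can be covered by countably many `k`-dimensional affine subspaces that do not contain
the origin. -/
def CoveredByFlatsMissingZero {n : ℕ} (k : ℕ) (S : Set (EuclideanSpace ℝ (Fin n))) : Prop :=
  ∃ 𝒱 : Set (AffineSubspace ℝ (EuclideanSpace ℝ (Fin n))), 𝒱.Countable ∧
    (∀ V ∈ 𝒱, (V : Set (EuclideanSpace ℝ (Fin n))).Nonempty ∧
      Module.finrank ℝ V.direction = k ∧ (0 : EuclideanSpace ℝ (Fin n)) ∉ V) ∧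
    S ⊆ ⋃ V ∈ 𝒱, (V : Set (EuclideanSpace ℝ (Fin n)))

/-- The set `x + r S`. It is a scaled copy of `S` centered at `x` when `0 < r`. -/
def scaledCopy {n : ℕ} (x : EuclideanSpace ℝ (Fin n)) (r : ℝ)
    (S : Set (EuclideanSpace ℝ (Fin n))) : Set (EuclideanSpace ℝ (Fin n)) :=
  (fun s => x + r • s) '' S

/-- The image `T(S)` of `S` under the rotation `T ∈ SO(n)`. -/
def rotate {n : ℕ} (T : Matrix.specialOrthogonalGroup (Fin n) ℝ)
    (S : Set (EuclideanSpace ℝ (Fin n))) : Set (EuclideanSpace ℝ (Fin n)) :=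
  (fun s => Matrix.toEuclideanLin (T : Matrix (Fin n) (Fin n) ℝ) s) '' S

/-- `A` contains a scaled copy of `S` centered at every point. -/
def ContainsScaledCopies {n : ℕ} (S A : Set (EuclideanSpace ℝ (Fin n))) : Prop :=
  ∀ x : EuclideanSpace ℝ (Fin n), ∃ r : ℝ, 0 < r ∧ scaledCopy x r S ⊆ A

/-- `A` contains a scaled and rotated copy of `S` centered at every point. -/
def ContainsScaledRotatedCopies {n : ℕ} (S A : Set (EuclideanSpace ℝ (Fin n))) : Prop :=
  ∀ x : EuclideanSpace ℝ (Fin n), ∃ r : ℝ, 0 < r ∧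
    ∃ T : Matrix.specialOrthogonalGroup (Fin n) ℝ, scaledCopy x r (rotate T S) ⊆ A

/-- `A` contains a rotated copy (of the original size) of `S` centered at every point. -/
def ContainsRotatedCopies {n : ℕ} (S A : Set (EuclideanSpace ℝ (Fin n))) : Prop :=
  ∀ x : EuclideanSpace ℝ (Fin n),
    ∃ T : Matrix.specialOrthogonalGroup (Fin n) ℝ, scaledCopy x 1 (rotate T S) ⊆ A

/-- `A` contains a rotated copy of every size of `S` centered at every point. -/
def ContainsRotatedCopiesOfEverySize {n : ℕ} (S A : Set (EuclideanSpace ℝ (Fin n))) : Prop :=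
  ∀ (x : EuclideanSpace ℝ (Fin n)) (r : ℝ), 0 < r →
    ∃ T : Matrix.specialOrthogonalGroup (Fin n) ℝ, scaledCopy x r (rotate T S) ⊆ A

/-! Upper bounds come from Baire category. Cover `S` by flats `v + L` with `0 ≠ v ⊥ L`. About a
fixed centre the admissible scalings, similarities or rotations form a Baire space. A σ-compact flat
that densely many of them carry into a Gδ set is carried there by residually many, so a single map
serves all flats at once. Every set has a Gδ hull of the same dimension
(`exists_isGδ_superset_dimH_eq`). Hence it suffices to find, for each flat, a set `F` of the right
dimension, independent of the centre, into which densely many maps about every centre send the flat.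
For scalings `F` is the union of the hyperplanes on which `⟪v, y⟫` is rational. For similarities it
is a countable dense family of copies of the flat: since the flat misses the centre, a small
rotation and dilation move it onto a nearby copy. For rotations the distance from the centre is
fixed, and one extra dimension, countably many copies of `span (L, v)`, makes up for that.

Two lower bounds are short: `A` projects onto the hyperplane orthogonal to a point of `S`, and `A`
contains a similar copy of `S`. The bound `k + 1` is an energy argument. Suppose `A` is null in
dimension `t < k + 1`, and cover it by dyadic balls of scales `r i` with separated centres. Let `m
i` be the volume of the set of centres `x` in the unit ball whose copy is recorded as meeting ball
`i`. Each copy has positive content in some dimension `s` with `2 s - t > k - 1`, so `∑ r i ^ s * m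
i` is bounded below. It is at most `λ ∑ r i ^ t + λ⁻¹ ∑ r i ^ (2 s - t) * m i ^ 2`, where the first
sum is as small as desired and the second is bounded independently of the cover
(`exists_tsum_mul_volume_sq_le`). For the latter, let flats at equal distance `ρ` from `x` and `y`
pass near many common net points. Then `y` is nearly at distance `ρ` from the flat of `x`
(`exists_card_mul_pow_mul_le_of_near_two_flats`), which confines `y` to a thin shell of small
volume. -/

/-! ### Gδ hulls and the category argument. -/

open Set Filter Topology in
theorem exists_open_cover_of_dimH_lt {X : Type*} [MetricSpace X] {F : Set X} {d : NNReal}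
    (hd : dimH F < d) {r : ℝ≥0∞} (hr : 0 < r) :
    ∃ U : ℕ → Set X, (∀ i, IsOpen (U i)) ∧ F ⊆ ⋃ i, U i ∧ (∀ i, Metric.ediam (U i) ≤ r) ∧
      ∑' i, Metric.ediam (U i) ^ (d : ℝ) ≤ r := by
  borelize X
  have hd0 : 0 < (d : ℝ) := by exact_mod_cast (zero_le.trans_lt hd : (0 : ℝ≥0∞) < d)
  wlog hrt : r ≠ ⊤ generalizing r
  · obtain ⟨U, h1, h2, h3, h4⟩ := this one_pos ENNReal.one_ne_top
    push Not at hrt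
    exact ⟨U, h1, h2, fun i => by simp [hrt], by simp [hrt]⟩
  have hμ := hausdorffMeasure_of_dimH_lt hd
  rw [Measure.hausdorffMeasure_apply] at hμ
  have h1 := (iSup₂_le_iff.1 hμ.le) (r / 2) (ENNReal.half_pos hr.ne')
  have h2 : _ < r / 2 := h1.trans_lt (ENNReal.half_pos hr.ne')
  simp only [iInf_lt_iff] at h2
  obtain ⟨t, hFt, htd, hts⟩ := h2
  -- The sets `t i` use up `r / 2`; the other half pays for thickening them into open sets.
  obtain ⟨ε, hε0, hεs⟩ := ENNReal.exists_pos_sum_of_countable (ENNReal.half_pos hr.ne').ne' ℕ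
  have hex : ∀ i, ∃ ρ : ℝ, 0 < ρ ∧ Metric.ediam (t i) + 2 * ENNReal.ofReal ρ ≤ r ∧
      (Metric.ediam (t i) + 2 * ENNReal.ofReal ρ) ^ (d : ℝ) ≤ Metric.ediam (t i) ^ (d : ℝ) + ε i := by
    intro i
    have hlt : Metric.ediam (t i) < r := (htd i).trans_lt (ENNReal.half_lt_self hr.ne' hrt)
    have hT : Tendsto (fun ρ : ℝ => Metric.ediam (t i) + 2 * ENNReal.ofReal ρ) (𝓝[>] 0)
        (𝓝 (Metric.ediam (t i))) := by
      have h : Continuous fun ρ : ℝ => Metric.ediam (t i) + 2 * ENNReal.ofReal ρ :=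
        continuous_const.add ((ENNReal.continuous_const_mul (by simp)).comp
          ENNReal.continuous_ofReal)
      have := h.tendsto 0
      simp only [ENNReal.ofReal_zero, mul_zero, add_zero] at this
      exact this.mono_left nhdsWithin_le_nhds
    have hT2 := (ENNReal.continuous_rpow_const (y := (d : ℝ))).continuousAt.tendsto.comp hT
    have hlt2 : Metric.ediam (t i) ^ (d : ℝ) < Metric.ediam (t i) ^ (d : ℝ) + ε i :=
      ENNReal.lt_add_right (ENNReal.rpow_ne_top_of_nonneg hd0.le hlt.ne_top)
        (by simpa using (hε0 i).ne')
    obtain ⟨ρ, ⟨h1, h2⟩, h3⟩ := (((hT.eventually (gt_mem_nhds hlt)).and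
      (hT2.eventually (gt_mem_nhds hlt2))).and self_mem_nhdsWithin).exists
    exact ⟨ρ, h3, h1.le, h2.le⟩
  choose ρ hρ0 hρr hρd using hex
  have hdiam : ∀ i, Metric.ediam (Metric.thickening (ρ i) (t i)) ≤
      Metric.ediam (t i) + 2 * ENNReal.ofReal (ρ i) := fun i => by
    have := Metric.ediam_thickening_le (s := t i) (ρ i).toNNReal
    rwa [Real.coe_toNNReal _ (hρ0 i).le] at this
  refine ⟨fun i => Metric.thickening (ρ i) (t i), fun i => Metric.isOpen_thickening,
    hFt.trans (iUnion_mono fun i => Metric.self_subset_thickening (hρ0 i) _),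
    fun i => (hdiam i).trans (hρr i), ?_⟩
  calc ∑' i, Metric.ediam (Metric.thickening (ρ i) (t i)) ^ (d : ℝ)
      ≤ ∑' i, ((⨆ _ : (t i).Nonempty, Metric.ediam (t i) ^ (d : ℝ)) + ε i) := by
        refine ENNReal.tsum_le_tsum fun i => ?_
        rcases (t i).eq_empty_or_nonempty with h | h
        · simp [h, ENNReal.zero_rpow_of_pos hd0]
        · simp only [h, iSup_pos]
          exact (ENNReal.rpow_le_rpow (hdiam i) hd0.le).trans (hρd i)
    _ ≤ r / 2 + r / 2 := by
        rw [ENNReal.tsum_add]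
        exact add_le_add hts.le hεs.le
    _ = r := ENNReal.add_halves r

open Set Filter Topology in
/-- Every set is contained in a `Gδ` set of the same Hausdorff dimension. -/
theorem exists_isGδ_superset_dimH_eq {X : Type*} [MetricSpace X] (F : Set X) :
    ∃ A, F ⊆ A ∧ IsGδ A ∧ dimH A = dimH F := by
  borelize X
  by_cases htop : dimH F = ⊤
  · refine ⟨univ, subset_univ _, IsGδ.univ, ?_⟩
    rw [htop]; exact top_unique (htop ▸ dimH_mono (subset_univ F))
  lift dimH F to NNReal using htop with D hD
  have hlt : ∀ j : ℕ, dimH F < ((D + (j + 1 : NNReal)⁻¹ : NNReal) : ℝ≥0∞) := by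
    intro j
    rw [← hD]
    exact_mod_cast lt_add_of_pos_right D (by positivity)
  choose U hUo hUF hUd hUs using fun j : ℕ => exists_open_cover_of_dimH_lt (hlt j)
    (r := (j + 1 : ℝ≥0∞)⁻¹) (by simp)
  have hr0 : Tendsto (fun j : ℕ => (j + 1 : ℝ≥0∞)⁻¹) atTop (𝓝 0) := by
    have := ENNReal.tendsto_inv_nat_nhds_zero.comp (tendsto_add_atTop_nat 1)
    simpa [Function.comp_def] using this
  refine ⟨⋂ j, ⋃ i, U j i, subset_iInter hUF,
    IsGδ.iInter_of_isOpen fun j => isOpen_iUnion (hUo j), le_antisymm ?_ (hD ▸ dimH_mono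
    (subset_iInter hUF))⟩
  refine dimH_le fun d hd => ?_
  by_contra! hlt'
  have hlt' : (D : ℝ) < d := by exact_mod_cast hlt'
  have h0 : Measure.hausdorffMeasure (d : ℝ) (⋂ j, ⋃ i, U j i) = 0 := by
    refine le_antisymm ((Measure.hausdorffMeasure_le_liminf_tsum (l := atTop) (d : ℝ) _
      (fun j : ℕ => (j + 1 : ℝ≥0∞)⁻¹) hr0 U (.of_forall hUd)
      (.of_forall fun j => iInter_subset _ j)).trans ?_) zero_le
    rw [← hr0.liminf_eq]
    -- Once `D + 1 / (j + 1) < d`, diameters at most `1` make the `d`-sums no larger than the sums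
    -- controlled by `hUs`.
    have hev : ∀ᶠ j : ℕ in atTop, (D + (j + 1 : ℝ)⁻¹) < d := by
      have : Tendsto (fun j : ℕ => (D : ℝ) + ((j : ℝ) + 1)⁻¹) atTop (𝓝 (D + 0)) :=
        tendsto_const_nhds.add (by simpa using tendsto_one_div_add_atTop_nhds_zero_nat (𝕜 := ℝ))
      rw [add_zero] at this
      exact this.eventually (gt_mem_nhds hlt')
    refine liminf_le_liminf ?_
    filter_upwards [hev] with j hj
    refine le_trans (ENNReal.tsum_le_tsum fun i => ?_) (hUs j)
    refine ENNReal.rpow_le_rpow_of_exponent_ge ((hUd j i).trans ?_) ?_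
    · simp
    · push_cast; exact hj.le
  simp [h0] at hd

-- For `K m` compact and `U n` open, the parameters carrying `K m` into `U n` form an open set, by
-- the tube lemma. Each of these sets contains the given dense set, and countably many of them cut
-- it out.
open Set Filter Topology in
theorem residual_setOf_mapsTo {Q X Y : Type*} [TopologicalSpace Q] [TopologicalSpace X]
    [TopologicalSpace Y] {f : Q → X → Y} (hf : Continuous fun p : Q × X => f p.1 p.2)
    {V : Set X} (hV : IsSigmaCompact V) {A : Set Y} (hA : IsGδ A)
    (hd : Dense {q | MapsTo (f q) V A}) : {q | MapsTo (f q) V A} ∈ residual Q := by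
  obtain ⟨K, hK, rfl⟩ := hV
  obtain ⟨U, hU, rfl⟩ := isGδ_iff_eq_iInter_nat.1 hA
  have : {q | MapsTo (f q) (⋃ m, K m) (⋂ n, U n)} =
      ⋂ m, ⋂ n, {q | ∀ x ∈ K m, f q x ∈ U n} := by
    ext q
    simp only [MapsTo, mem_ofPred_eq, mem_iUnion, mem_iInter]
    grind
  rw [this] at hd ⊢
  refine countable_iInter_mem.2 fun m => countable_iInter_mem.2 fun n => ?_
  refine residual_of_dense_open ?_ (hd.mono ((iInter_subset _ m).trans (iInter_subset _ n)))
  rw [isOpen_iff_mem_nhds]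
  intro q hq
  exact (hK m).eventually_forall_of_forall_eventually fun x hx =>
    (hf.isOpen_preimage _ (hU n)).mem_nhds (hq x hx)

open Set in
/-- If countably many `σ`-compact sets `V i` can be mapped into sets `F z i` of dimension at most
`d` by a dense set of maps from a Baire family, then all of them can simultaneously be mapped
into one Borel set of dimension at most `d`, by some member of the family. -/
theorem exists_measurableSet_dimH_le_forall_exists_mapsTo {Q Z X Y ι : Type*} [TopologicalSpace Q]
    [BaireSpace Q] [Nonempty Q] [TopologicalSpace X] [MetricSpace Y] [MeasurableSpace Y]
    [BorelSpace Y] [Countable ι] {f : Z → Q → X → Y}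
    (hf : ∀ z, Continuous fun p : Q × X => f z p.1 p.2) {V : ι → Set X}
    (hV : ∀ i, IsSigmaCompact (V i)) {F : ι → Set Y} {d : ℝ≥0∞} (hF : ∀ i, dimH (F i) ≤ d)
    (hd : ∀ z i, Dense {q | MapsTo (f z q) (V i) (F i)}) :
    ∃ A, MeasurableSet A ∧ dimH A ≤ d ∧ ∀ z, ∃ q, MapsTo (f z q) (⋃ i, V i) A := by
  choose G hFG hG hGd using fun i => exists_isGδ_superset_dimH_eq (F i)
  refine ⟨⋃ i, G i, .iUnion fun i => (hG i).measurableSet, ?_, fun z => ?_⟩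
  · rw [dimH_iUnion]
    exact iSup_le fun i => (hGd i).trans_le (hF i)
  · have : ⋂ i, {q | MapsTo (f z q) (V i) (G i)} ∈ residual Q :=
      countable_iInter_mem.2 fun i => residual_setOf_mapsTo (hf z) (hV i) (hG i)
        ((hd z i).mono fun q hq => hq.mono_right (hFG i))
    obtain ⟨q, hq⟩ := (dense_of_mem_residual this).nonempty
    refine ⟨q, fun x hx => ?_⟩
    obtain ⟨i, hi⟩ := mem_iUnion.1 hx
    exact mem_iUnion.2 ⟨i, mem_iInter.1 hq i hi⟩

/-! ### Rotations and the topology of `SO(n)`. -/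

theorem inner_toEuclideanLin_specialOrthogonal {n : ℕ}
    (T : Matrix.specialOrthogonalGroup (Fin n) ℝ) (x y : EuclideanSpace ℝ (Fin n)) :
    inner ℝ (Matrix.toEuclideanLin (T : Matrix (Fin n) (Fin n) ℝ) x)
      (Matrix.toEuclideanLin (T : Matrix (Fin n) (Fin n) ℝ) y) = inner ℝ x y := by
  have h : (T : Matrix (Fin n) (Fin n) ℝ).transpose * (T : Matrix (Fin n) (Fin n) ℝ) = 1 :=
    (Matrix.mem_orthogonalGroup_iff' _ _).1 (Matrix.mem_specialOrthogonalGroup_iff.1 T.2).1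
  simp only [Matrix.toLpLin_apply, EuclideanSpace.inner_eq_star_dotProduct, star_trivial]
  rw [Matrix.dotProduct_mulVec, ← Matrix.mulVec_transpose, Matrix.mulVec_mulVec, h,
    Matrix.one_mulVec]

/-- The linear isometry of Euclidean space given by a special orthogonal matrix. -/
noncomputable def specialOrthogonalIsometry {n : ℕ}
    (T : Matrix.specialOrthogonalGroup (Fin n) ℝ) :
    EuclideanSpace ℝ (Fin n) ≃ₗᵢ[ℝ] EuclideanSpace ℝ (Fin n) :=
  LinearIsometry.toLinearIsometryEquiv
    ((Matrix.toEuclideanLin (T : Matrix (Fin n) (Fin n) ℝ)).isometryOfInner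
      (inner_toEuclideanLin_specialOrthogonal T)) rfl

theorem specialOrthogonalIsometry_apply {n : ℕ} (T : Matrix.specialOrthogonalGroup (Fin n) ℝ)
    (x : EuclideanSpace ℝ (Fin n)) :
    specialOrthogonalIsometry T x = Matrix.toEuclideanLin (T : Matrix (Fin n) (Fin n) ℝ) x := rfl

theorem specialOrthogonalIsometry_mul_apply {n : ℕ}
    (T T' : Matrix.specialOrthogonalGroup (Fin n) ℝ) (x : EuclideanSpace ℝ (Fin n)) :
    specialOrthogonalIsometry (T * T') x =
      specialOrthogonalIsometry T (specialOrthogonalIsometry T' x) := by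
  simp [specialOrthogonalIsometry_apply, Matrix.toLpLin_apply, Matrix.mulVec_mulVec]

theorem continuous_specialOrthogonalIsometry {n : ℕ} :
    Continuous fun p : Matrix.specialOrthogonalGroup (Fin n) ℝ × EuclideanSpace ℝ (Fin n) =>
      specialOrthogonalIsometry p.1 p.2 := by
  simp only [specialOrthogonalIsometry_apply, Matrix.toLpLin_apply]
  refine (PiLp.continuous_toLp 2 _).comp ?_
  exact (continuous_subtype_val.comp continuous_fst).matrix_mulVec
    ((PiLp.continuous_ofLp 2 _).comp continuous_snd)

theorem continuous_specialOrthogonalIsometry_symm {n : ℕ} :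
    Continuous fun p : Matrix.specialOrthogonalGroup (Fin n) ℝ × EuclideanSpace ℝ (Fin n) =>
      (specialOrthogonalIsometry p.1).symm p.2 := by
  have h : ∀ p : Matrix.specialOrthogonalGroup (Fin n) ℝ × EuclideanSpace ℝ (Fin n),
      (specialOrthogonalIsometry p.1).symm p.2 =
        WithLp.toLp 2 ((p.1 : Matrix (Fin n) (Fin n) ℝ).transpose.mulVec (WithLp.ofLp p.2)) := by
    intro p
    rw [LinearIsometryEquiv.symm_apply_eq, specialOrthogonalIsometry_apply]
    have h : (p.1 : Matrix (Fin n) (Fin n) ℝ) * (p.1 : Matrix (Fin n) (Fin n) ℝ).transpose = 1 :=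
      (Matrix.mem_orthogonalGroup_iff _ _).1 (Matrix.mem_specialOrthogonalGroup_iff.1 p.1.2).1
    simp [Matrix.toLpLin_apply, Matrix.mulVec_mulVec, h]
  simp only [h]
  refine (PiLp.continuous_toLp 2 _).comp ?_
  exact (continuous_subtype_val.comp continuous_fst).matrix_transpose.matrix_mulVec
    ((PiLp.continuous_ofLp 2 _).comp continuous_snd)

/-- The matrix of the reflection in the hyperplane orthogonal to `a`. -/
noncomputable def reflectionMatrix {n : ℕ} (a : EuclideanSpace ℝ (Fin n)) :
    Matrix (Fin n) (Fin n) ℝ :=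
  1 - (2 / ‖a‖ ^ 2) • Matrix.vecMulVec (WithLp.ofLp a) (WithLp.ofLp a)

theorem toEuclideanLin_reflectionMatrix {n : ℕ} (a x : EuclideanSpace ℝ (Fin n)) :
    Matrix.toEuclideanLin (reflectionMatrix a) x = x - (2 / ‖a‖ ^ 2 * inner ℝ a x) • a := by
  ext i
  simp [reflectionMatrix, Matrix.toLpLin_apply, Matrix.vecMulVec_mulVec, EuclideanSpace.inner_eq_star_dotProduct, dotProduct_comm]
  ring

theorem dotProduct_ofLp_self {n : ℕ} (a : EuclideanSpace ℝ (Fin n)) :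
    WithLp.ofLp a ⬝ᵥ WithLp.ofLp a = ‖a‖ ^ 2 := by
  rw [← real_inner_self_eq_norm_sq, EuclideanSpace.inner_eq_star_dotProduct]
  simp

theorem reflectionMatrix_mul_self {n : ℕ} {a : EuclideanSpace ℝ (Fin n)} (ha : a ≠ 0) :
    reflectionMatrix a * reflectionMatrix a = 1 := by
  have h : ‖a‖ ^ 2 ≠ 0 := by simpa using ha
  rw [reflectionMatrix, sub_mul, mul_sub, mul_sub]
  simp only [Matrix.mul_one, Matrix.one_mul, Matrix.smul_mul, Matrix.mul_smul,
    Matrix.vecMulVec_mul_vecMulVec, dotProduct_ofLp_self, smul_smul, Matrix.vecMulVec_smul]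
  have : 2 / ‖a‖ ^ 2 * (2 / ‖a‖ ^ 2 * ‖a‖ ^ 2) = 2 / ‖a‖ ^ 2 + 2 / ‖a‖ ^ 2 := by
    field_simp; norm_num
  rw [this, add_smul]
  abel

theorem transpose_reflectionMatrix {n : ℕ} (a : EuclideanSpace ℝ (Fin n)) :
    (reflectionMatrix a).transpose = reflectionMatrix a := by
  simp [reflectionMatrix, Matrix.transpose_sub, Matrix.transpose_smul, Matrix.transpose_vecMulVec]

theorem det_reflectionMatrix {n : ℕ} {a : EuclideanSpace ℝ (Fin n)} (ha : a ≠ 0) :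
    (reflectionMatrix a).det = -1 := by
  have h : ‖a‖ ^ 2 ≠ 0 := by simpa using ha
  have : reflectionMatrix a = 1 + Matrix.replicateCol Unit (-(2 / ‖a‖ ^ 2) • WithLp.ofLp a) *
      Matrix.replicateRow Unit (WithLp.ofLp a) := by
    rw [← Matrix.vecMulVec_eq, reflectionMatrix, Matrix.smul_vecMulVec, neg_smul, sub_eq_add_neg]
  rw [this, Matrix.det_one_add_replicateCol_mul_replicateRow, dotProduct_smul,
    dotProduct_ofLp_self]
  simp only [smul_eq_mul]
  field_simp
  norm_num

open Filter Topology in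
/-- A vector `u ≠ 0` can be moved to each nearby vector `u'` of the same length by a rotation that
fixes the orthogonal complement of `u` and `u'` and depends continuously on `u'`. -/
theorem exists_rotation {n : ℕ} {u : EuclideanSpace ℝ (Fin n)} (hu : u ≠ 0) :
    ∃ R : EuclideanSpace ℝ (Fin n) → Matrix.specialOrthogonalGroup (Fin n) ℝ,
      ContinuousAt R u ∧ R u = 1 ∧ ∀ u', ‖u'‖ = ‖u‖ → u + u' ≠ 0 →
        specialOrthogonalIsometry (R u') u = u' ∧ ∀ w, inner ℝ u w = 0 → inner ℝ u' w = 0 →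
          specialOrthogonalIsometry (R u') w = w := by
  classical
  have hmem : ∀ u', u + u' ≠ 0 → reflectionMatrix (u + u') * reflectionMatrix u ∈
      Matrix.specialOrthogonalGroup (Fin n) ℝ := by
    intro u' hu'
    refine Matrix.mem_specialOrthogonalGroup_iff.2 ⟨(Matrix.mem_orthogonalGroup_iff _ _).2 ?_, ?_⟩
    · rw [Matrix.transpose_mul, transpose_reflectionMatrix,
        transpose_reflectionMatrix, Matrix.mul_assoc, ← Matrix.mul_assoc (reflectionMatrix u),
        reflectionMatrix_mul_self hu, Matrix.one_mul, reflectionMatrix_mul_self hu']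
    · rw [Matrix.det_mul, det_reflectionMatrix hu, det_reflectionMatrix hu']; norm_num
  have huu : u + u ≠ 0 := by rw [← two_smul ℝ]; simpa using hu
  -- The reflection along `u` takes `u` to `-u`, and the one along `u + u'` takes `-u` to `u'` when
  -- the lengths agree. The value `1` at `u' = -u` is arbitrary.
  refine ⟨fun u' => if h : u + u' ≠ 0 then ⟨_, hmem u' h⟩ else 1, ?_, ?_, ?_⟩
  · rw [Topology.IsInducing.subtypeVal.continuousAt_iff]
    have hev : ∀ᶠ u' in 𝓝 u, u + u' ≠ 0 :=
      (continuous_const.add continuous_id).continuousAt.eventually_ne huu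
    have hc : ContinuousAt (fun u' => reflectionMatrix (u + u') * reflectionMatrix u) u := by
      refine ContinuousAt.mul ?_ continuousAt_const
      unfold reflectionMatrix
      refine continuousAt_const.sub (ContinuousAt.fun_smul ?_ ?_)
      · exact ContinuousAt.div continuousAt_const (by fun_prop) (by simpa using huu)
      · refine Continuous.continuousAt ?_
        refine Continuous.matrix_vecMulVec ?_ ?_ <;> fun_prop
    refine hc.congr ?_
    filter_upwards [hev] with u' hu'
    simp [hu']
  · have : reflectionMatrix (u + u) = reflectionMatrix u := by
      unfold reflectionMatrix
      rw [← two_smul ℝ u, norm_smul, WithLp.ofLp_smul, Matrix.smul_vecMulVec,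
        Matrix.vecMulVec_smul, smul_smul, smul_smul]
      congr 2
      have : ‖u‖ ≠ 0 := by simpa using hu
      norm_num
      field_simp
    simp only [dif_pos huu]
    ext1
    simp [this, reflectionMatrix_mul_self hu]
  · intro u' hn hu'
    have h1 : ‖u + u'‖ ^ 2 = 2 * inner ℝ (u + u') u := by
      rw [norm_add_sq_real, hn, inner_add_left, real_inner_self_eq_norm_sq, real_inner_comm u u']
      ring
    have hne : ‖u + u'‖ ^ 2 ≠ 0 := by simpa using hu'
    have hnu : ‖u‖ ^ 2 ≠ 0 := by simpa using hu
    have happ : ∀ w, specialOrthogonalIsometry ⟨_, hmem u' hu'⟩ w =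
        Matrix.toEuclideanLin (reflectionMatrix (u + u'))
          (Matrix.toEuclideanLin (reflectionMatrix u) w) := fun w => by
      simp [specialOrthogonalIsometry_apply, Matrix.toLpLin_apply, Matrix.mulVec_mulVec]
    simp only [dif_pos hu']
    refine ⟨?_, fun w hw hw' => ?_⟩
    · rw [happ, toEuclideanLin_reflectionMatrix u, real_inner_self_eq_norm_sq,
        div_mul_cancel₀ _ hnu, two_smul, sub_add_cancel_left, map_neg,
        toEuclideanLin_reflectionMatrix, div_mul_eq_mul_div, ← h1, div_self hne]
      simp
    · rw [happ, toEuclideanLin_reflectionMatrix u, hw, mul_zero, zero_smul, sub_zero,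
        toEuclideanLin_reflectionMatrix, inner_add_left, hw, hw']
      simp

instance secondCountableTopology_specialOrthogonalGroup {n : ℕ} :
    SecondCountableTopology (Matrix.specialOrthogonalGroup (Fin n) ℝ) :=
  haveI : SecondCountableTopology (Matrix (Fin n) (Fin n) ℝ) :=
    inferInstanceAs (SecondCountableTopology (Fin n → Fin n → ℝ))
  TopologicalSpace.Subtype.secondCountableTopology _

instance locallyCompactSpace_specialOrthogonalGroup {n : ℕ} :
    LocallyCompactSpace (Matrix.specialOrthogonalGroup (Fin n) ℝ) := by
  have : LocallyCompactSpace (Matrix (Fin n) (Fin n) ℝ) :=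
    inferInstanceAs (LocallyCompactSpace (Fin n → Fin n → ℝ))
  refine IsClosed.locallyCompactSpace ?_
  have : (Matrix.specialOrthogonalGroup (Fin n) ℝ : Set (Matrix (Fin n) (Fin n) ℝ)) =
      {M | M * M.transpose = 1} ∩ {M | M.det = 1} := by
    ext M
    simp only [SetLike.mem_coe, Matrix.mem_specialOrthogonalGroup_iff, Matrix.mem_orthogonalGroup_iff]
    rfl
  rw [this]
  exact (isClosed_eq (by fun_prop) continuous_const).inter
    (isClosed_eq (by fun_prop) continuous_const)

/-! ### Moving flats into countable unions of flats. -/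

theorem dimH_submodule {E : Type*} [NormedAddCommGroup E] [InnerProductSpace ℝ E]
    [FiniteDimensional ℝ E] (L : Submodule ℝ E) :
    dimH (L : Set E) = Module.finrank ℝ L := by
  have := L.subtypeₗᵢ.isometry.dimH_image Set.univ
  rw [Real.dimH_univ_eq_finrank] at this
  simpa using this

open Filter Topology Set in
/-- A `k`-flat missing the origin can be moved into a suitable countable union of `k`-flats by a
dense set of similarities with any prescribed centre. -/
theorem exists_dense_similarity_mapsTo {n : ℕ} (L : Submodule ℝ (EuclideanSpace ℝ (Fin n)))
    {v : EuclideanSpace ℝ (Fin n)} (hv : v ≠ 0) (hvL : v ∈ Lᗮ) :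
    ∃ F : Set (EuclideanSpace ℝ (Fin n)), dimH F ≤ Module.finrank ℝ L ∧
      ∀ x, Dense {q : ℝ × Matrix.specialOrthogonalGroup (Fin n) ℝ |
        MapsTo (fun s => x + Real.exp q.1 • specialOrthogonalIsometry q.2 s) {y | y - v ∈ L} F} := by
  obtain ⟨D, hDc, hD⟩ := TopologicalSpace.exists_countable_dense
    (EuclideanSpace ℝ (Fin n) × ℝ × Matrix.specialOrthogonalGroup (Fin n) ℝ)
  refine ⟨⋃ p ∈ D, (fun s => p.1 + Real.exp p.2.1 • specialOrthogonalIsometry p.2.2 s) ''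
    {y | y - v ∈ L}, ?_, fun x => ?_⟩
  · rw [dimH_bUnion hDc]
    refine iSup₂_le fun p hp => ?_
    have : (fun s => p.1 + Real.exp p.2.1 • specialOrthogonalIsometry p.2.2 s) '' {y | y - v ∈ L} =
        (fun s => p.1 + Real.exp p.2.1 • specialOrthogonalIsometry p.2.2 (v + s)) '' L := by
      ext y
      constructor
      · rintro ⟨s, hs, rfl⟩
        exact ⟨s - v, hs, by simp⟩
      · rintro ⟨s, hs, rfl⟩
        exact ⟨v + s, by simpa using hs, rfl⟩
    rw [this, ← dimH_submodule]
    have hlip : LipschitzWith (Real.exp p.2.1).toNNReal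
        (fun s => p.1 + Real.exp p.2.1 • specialOrthogonalIsometry p.2.2 (v + s)) := by
      refine LipschitzWith.of_dist_le_mul fun a b => ?_
      rw [Real.coe_toNNReal _ (Real.exp_pos _).le, dist_add_left, dist_smul₀,
        LinearIsometryEquiv.dist_map, dist_add_left, Real.norm_of_nonneg (Real.exp_pos _).le]
    exact hlip.dimH_image_le _
  · obtain ⟨R, hRc, hR1, hR⟩ := exists_rotation hv
    have hv0 : ‖v‖ ≠ 0 := by simpa using hv
    -- In the coordinates of the similarity `p`, the centre `x` becomes a point `z`, and `w p`
    -- points from `z` to its foot on the flat `v + L`. At `p = (x, q)` it equals `v`.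
    let w : EuclideanSpace ℝ (Fin n) × ℝ × Matrix.specialOrthogonalGroup (Fin n) ℝ →
        EuclideanSpace ℝ (Fin n) := fun p =>
      v - Lᗮ.starProjection ((specialOrthogonalIsometry p.2.2).symm (Real.exp (-p.2.1) • (x - p.1)))
    have hwc : Continuous w := by
      have h : Continuous fun p : EuclideanSpace ℝ (Fin n) × ℝ ×
          Matrix.specialOrthogonalGroup (Fin n) ℝ => (p.2.2, Real.exp (-p.2.1) • (x - p.1)) := by
        fun_prop
      have h' := continuous_specialOrthogonalIsometry_symm.comp h
      simp only [Function.comp_def] at h'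
      exact continuous_const.sub (Lᗮ.starProjection.continuous.comp h')
    intro q
    rw [mem_closure_iff_nhds]
    intro N hN
    have hwx : w (x, q) = v := by simp [w]
    let u' := fun p => (‖v‖ / ‖w p‖) • w p
    have hu'c : ContinuousAt u' (x, q) := by
      refine ContinuousAt.fun_smul (ContinuousAt.div continuousAt_const hwc.norm.continuousAt ?_)
        hwc.continuousAt
      rwa [hwx]
    have hu'x : u' (x, q) = v := by simp [u', hwx, hv0]
    -- Correct `p` by the dilation and rotation that take `v` to `w p` and preserve `L`: about the
    -- centre `x`, the result sends the flat into the copy belonging to `p`.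
    let Φ : EuclideanSpace ℝ (Fin n) × ℝ × Matrix.specialOrthogonalGroup (Fin n) ℝ →
        ℝ × Matrix.specialOrthogonalGroup (Fin n) ℝ :=
      fun p => (p.2.1 + Real.log (‖w p‖ / ‖v‖), p.2.2 * R (u' p))
    have hΦ : ContinuousAt Φ (x, q) := by
      refine ContinuousAt.prodMk ?_ ?_
      · refine ContinuousAt.add (by fun_prop) (ContinuousAt.log ?_ ?_)
        · exact (hwc.norm.div_const _).continuousAt
        · simp [hwx, hv0]
      · refine ContinuousAt.mul (by fun_prop) ?_
        exact ContinuousAt.comp (g := R) (by rwa [hu'x]) hu'c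
    have hΦx : Φ (x, q) = q := by simp [Φ, hwx, hu'x, hR1, hv0]
    have h1 : ∀ᶠ p in 𝓝 (x, q), Φ p ∈ N := hΦ.eventually (by rwa [hΦx])
    have h2 : ∀ᶠ p in 𝓝 (x, q), w p ≠ 0 := hwc.continuousAt.eventually_ne (by rwa [hwx])
    have h3 : ∀ᶠ p in 𝓝 (x, q), v + u' p ≠ 0 :=
      (continuousAt_const.fun_add hu'c).eventually_ne (by
        simp only [hu'x, ← two_smul ℝ v]; simpa using hv)
    obtain ⟨p, ⟨⟨hp1, hp2⟩, hp3⟩, hpD⟩ := mem_closure_iff_nhds.1 (hD (x, q)) _ (h1.and h2 |>.and h3)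
    refine ⟨Φ p, hp1, fun s hs => mem_iUnion₂.2 ⟨p, hpD, ?_⟩⟩
    have hwp : ‖w p‖ ≠ 0 := by simpa using hp2
    have hwL : w p ∈ Lᗮ := Lᗮ.sub_mem hvL (Submodule.starProjection_apply_mem _ _)
    obtain ⟨hRu, hRw⟩ := hR (u' p) (by simp [u', norm_smul, hwp]) hp3
    have hRs : specialOrthogonalIsometry (R (u' p)) s = u' p + (s - v) := by
      have : specialOrthogonalIsometry (R (u' p)) (s - v) = s - v :=
        hRw _ (Submodule.inner_left_of_mem_orthogonal hs hvL)
          (Submodule.inner_left_of_mem_orthogonal hs (Lᗮ.smul_mem _ hwL))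
      conv_rhs => rw [← hRu, ← this, ← map_add]
      simp
    set z := (specialOrthogonalIsometry p.2.2).symm (Real.exp (-p.2.1) • (x - p.1)) with hz
    have hxz : x = p.1 + Real.exp p.2.1 • specialOrthogonalIsometry p.2.2 z := by
      rw [hz, LinearIsometryEquiv.apply_symm_apply, smul_smul, ← Real.exp_add]; simp
    refine ⟨z + (‖w p‖ / ‖v‖) • specialOrthogonalIsometry (R (u' p)) s, ?_, ?_⟩
    · have : z + (‖w p‖ / ‖v‖) • specialOrthogonalIsometry (R (u' p)) s - v =
          (z - Lᗮ.starProjection z) + (‖w p‖ / ‖v‖) • (s - v) := by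
        have hu : (‖w p‖ / ‖v‖) • u' p = v - Lᗮ.starProjection z := by
          simp only [u', smul_smul]
          rw [div_mul_div_cancel₀ hv0, div_self hwp, one_smul]
        rw [hRs, smul_add, hu]; abel
      show _ ∈ L
      rw [this]
      refine L.add_mem ?_ (L.smul_mem _ hs)
      have := Submodule.sub_starProjection_mem_orthogonal (K := Lᗮ) z
      rwa [Submodule.orthogonal_orthogonal] at this
    · have hexp : Real.exp (Real.log (‖w p‖ / ‖v‖)) = ‖w p‖ / ‖v‖ :=
        Real.exp_log (by positivity)
      simp only [Φ]
      conv_rhs => rw [hxz]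
      rw [specialOrthogonalIsometry_mul_apply, Real.exp_add, hexp, map_add, map_smul, smul_add,
        smul_smul, add_assoc]

open Filter Topology Set in
/-- A flat with direction `L` through `v ⊥ L` can be rotated about any given centre into a suitable
countable union of flats of dimension `dim W`, where `W` is the span of `v` and `L`. -/
theorem exists_dense_rotation_mapsTo {n : ℕ} {L W : Submodule ℝ (EuclideanSpace ℝ (Fin n))}
    (hLW : L ≤ W) :
    ∃ F : Set (EuclideanSpace ℝ (Fin n)), dimH F ≤ Module.finrank ℝ W ∧
      ∀ x, ∀ v ∈ W, v ≠ 0 → v ∈ Lᗮ → Dense {q : Matrix.specialOrthogonalGroup (Fin n) ℝ |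
        MapsTo (fun s => x + specialOrthogonalIsometry q s) {y | y - v ∈ L} F} := by
  obtain ⟨D, hDc, hD⟩ := TopologicalSpace.exists_countable_dense
    (EuclideanSpace ℝ (Fin n) × Matrix.specialOrthogonalGroup (Fin n) ℝ)
  refine ⟨⋃ p ∈ D, (fun s => p.1 + specialOrthogonalIsometry p.2 s) '' W, ?_,
    fun x v hvW hv hvL => ?_⟩
  · rw [dimH_bUnion hDc]
    refine iSup₂_le fun p hp => ?_
    rw [← dimH_submodule]
    have : Isometry (fun s => p.1 + specialOrthogonalIsometry p.2 s) :=
      (isometry_add_left p.1).comp (specialOrthogonalIsometry p.2).isometry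
    exact (this.dimH_image _).le
  · obtain ⟨R, hRc, hR1, hR⟩ := exists_rotation hv
    have hv0 : ‖v‖ ≠ 0 := by simpa using hv
    let z : EuclideanSpace ℝ (Fin n) × Matrix.specialOrthogonalGroup (Fin n) ℝ →
        EuclideanSpace ℝ (Fin n) := fun p =>
      Wᗮ.starProjection ((specialOrthogonalIsometry p.2).symm (x - p.1))
    have hzc : Continuous z := by
      have h : Continuous fun p : EuclideanSpace ℝ (Fin n) ×
          Matrix.specialOrthogonalGroup (Fin n) ℝ => (p.2, x - p.1) := by fun_prop
      have h' := continuous_specialOrthogonalIsometry_symm.comp h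
      simp only [Function.comp_def] at h'
      exact Wᗮ.starProjection.continuous.comp h'
    intro q
    rw [mem_closure_iff_nhds]
    intro N hN
    have hzx : z (x, q) = 0 := by simp [z]
    -- Subtracting `z p` brings the displaced centre back into `W`. The coefficient of `v` restores
    -- the length `‖v‖`, by Pythagoras, since `z p ⊥ v`.
    let u' := fun p => √(1 - (‖z p‖ / ‖v‖) ^ 2) • v - z p
    have hu'c : Continuous u' := by
      refine .sub (.smul (.sqrt (continuous_const.sub ((hzc.norm.div_const _).pow 2)))
        continuous_const) hzc
    have hu'x : u' (x, q) = v := by simp [u', hzx]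
    let Φ : EuclideanSpace ℝ (Fin n) × Matrix.specialOrthogonalGroup (Fin n) ℝ →
        Matrix.specialOrthogonalGroup (Fin n) ℝ := fun p => p.2 * R (u' p)
    have hΦ : ContinuousAt Φ (x, q) := by
      refine ContinuousAt.mul (by fun_prop) ?_
      exact ContinuousAt.comp (g := R) (by rwa [hu'x]) hu'c.continuousAt
    have hΦx : Φ (x, q) = q := by simp [Φ, hu'x, hR1]
    have h1 : ∀ᶠ p in 𝓝 (x, q), Φ p ∈ N := hΦ.eventually (by rwa [hΦx])
    have h2 : ∀ᶠ p in 𝓝 (x, q), ‖z p‖ < ‖v‖ :=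
      hzc.norm.continuousAt.eventually (gt_mem_nhds (by simpa only [hzx, norm_zero, norm_pos_iff] using hv))
    have h3 : ∀ᶠ p in 𝓝 (x, q), v + u' p ≠ 0 :=
      (continuousAt_const.fun_add hu'c.continuousAt).eventually_ne (by
        simp only [hu'x, ← two_smul ℝ v]; simpa using hv)
    obtain ⟨p, ⟨⟨hp1, hp2⟩, hp3⟩, hpD⟩ := mem_closure_iff_nhds.1 (hD (x, q)) _ (h1.and h2 |>.and h3)
    refine ⟨Φ p, hp1, fun s hs => mem_iUnion₂.2 ⟨p, hpD, ?_⟩⟩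
    have hzW : z p ∈ Wᗮ := Submodule.starProjection_apply_mem _ _
    have hu'L : u' p ∈ Lᗮ := Lᗮ.sub_mem (Lᗮ.smul_mem _ hvL) (Submodule.orthogonal_le hLW hzW)
    have hle : (‖z p‖ / ‖v‖) ^ 2 ≤ 1 := by
      refine pow_le_one₀ (by positivity) (div_le_one_of_le₀ hp2.le (norm_nonneg _))
    have hnorm : ‖u' p‖ = ‖v‖ := by
      have h : ‖u' p‖ ^ 2 = ‖v‖ ^ 2 := by
        simp only [u']
        rw [norm_sub_sq_real, inner_smul_left, Submodule.inner_right_of_mem_orthogonal hvW hzW,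
          norm_smul, mul_pow, Real.norm_eq_abs, sq_abs, Real.sq_sqrt (by linarith)]
        field_simp
        simp
      exact (pow_left_inj₀ (norm_nonneg _) (norm_nonneg _) two_ne_zero).1 h
    obtain ⟨hRu, hRw⟩ := hR (u' p) hnorm hp3
    have hRs : specialOrthogonalIsometry (R (u' p)) s = u' p + (s - v) := by
      have : specialOrthogonalIsometry (R (u' p)) (s - v) = s - v :=
        hRw _ (Submodule.inner_left_of_mem_orthogonal hs hvL)
          (Submodule.inner_left_of_mem_orthogonal hs hu'L)
      conv_rhs => rw [← hRu, ← this, ← map_add]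
      simp
    set y := (specialOrthogonalIsometry p.2).symm (x - p.1) with hy
    have hxy : x = p.1 + specialOrthogonalIsometry p.2 y := by
      rw [hy, LinearIsometryEquiv.apply_symm_apply]; simp
    refine ⟨y + specialOrthogonalIsometry (R (u' p)) s, ?_, ?_⟩
    · have : y + specialOrthogonalIsometry (R (u' p)) s = (y - Wᗮ.starProjection y) +
          (√(1 - (‖z p‖ / ‖v‖) ^ 2) • v + (s - v)) := by
        rw [hRs]; simp only [u', z, ← hy]; abel
      rw [this]
      refine W.add_mem ?_ (W.add_mem (W.smul_mem _ hvW) (hLW hs))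
      have := Submodule.sub_starProjection_mem_orthogonal (K := Wᗮ) y
      rwa [Submodule.orthogonal_orthogonal] at this
    · simp only [Φ]
      conv_rhs => rw [hxy]
      rw [specialOrthogonalIsometry_mul_apply, map_add, add_assoc]

/-! ### Upper bounds: sets containing all the copies. -/

theorem AffineSubspace.exists_coe_eq_setOf_sub_mem {E : Type*} [NormedAddCommGroup E]
    [InnerProductSpace ℝ E] [FiniteDimensional ℝ E] {V : AffineSubspace ℝ E}
    (hne : (V : Set E).Nonempty) (h0 : (0 : E) ∉ V) :
    ∃ v : E, v ≠ 0 ∧ v ∈ V.directionᗮ ∧ (V : Set E) = {y | y - v ∈ V.direction} := by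
  obtain ⟨p, hp⟩ := hne
  have hpv : p - V.directionᗮ.starProjection p ∈ V.direction := by
    have := Submodule.sub_starProjection_mem_orthogonal (K := V.directionᗮ) p
    rwa [Submodule.orthogonal_orthogonal] at this
  have hv : V.directionᗮ.starProjection p ∈ V := by
    rw [← neg_mem_iff, neg_sub] at hpv
    have := AffineSubspace.vadd_mem_of_mem_direction hpv hp
    rwa [vadd_eq_add, sub_add_cancel] at this
  refine ⟨_, fun h => h0 (h ▸ hv), Submodule.starProjection_apply_mem _ _, ?_⟩
  ext y
  exact (AffineSubspace.vsub_right_mem_direction_iff_mem hv y).symm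

theorem isSigmaCompact_setOf_sub_mem {E : Type*} [NormedAddCommGroup E]
    [InnerProductSpace ℝ E] [FiniteDimensional ℝ E] (L : Submodule ℝ E) (v : E) :
    IsSigmaCompact {y | y - v ∈ L} := by
  have : IsClosed {y | y - v ∈ L} :=
    (Submodule.closed_of_finiteDimensional L).preimage (continuous_id.sub continuous_const)
  exact isSigmaCompact_univ.of_isClosed_subset this (Set.subset_univ _)

/-- A set covered by flats that miss the origin is covered by flats `v + L` with `0 ≠ v ⊥ L`. -/
theorem CoveredByFlatsMissingZero.exists_family {n k : ℕ} {S : Set (EuclideanSpace ℝ (Fin n))}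
    (hS : CoveredByFlatsMissingZero k S) :
    ∃ (ι : Type) (_ : Countable ι) (L : ι → Submodule ℝ (EuclideanSpace ℝ (Fin n)))
      (v : ι → EuclideanSpace ℝ (Fin n)), (∀ i, Module.finrank ℝ (L i) = k) ∧ (∀ i, v i ≠ 0) ∧
      (∀ i, v i ∈ (L i)ᗮ) ∧ S ⊆ ⋃ i, {y | y - v i ∈ L i} := by
  obtain ⟨𝒱, hc, h𝒱, hS⟩ := hS
  choose v hv0 hvL hv using fun V : 𝒱 =>
    AffineSubspace.exists_coe_eq_setOf_sub_mem (h𝒱 V V.2).1 (h𝒱 V V.2).2.2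
  refine ⟨𝒱, hc.to_subtype, fun V => V.1.direction, v, fun V => (h𝒱 V V.2).2.1, hv0, hvL,
    fun s hs => ?_⟩
  obtain ⟨V, hV, hsV⟩ := Set.mem_iUnion₂.1 (hS hs)
  refine Set.mem_iUnion.2 ⟨⟨V, hV⟩, ?_⟩
  rw [← hv ⟨V, hV⟩]
  exact hsV

theorem dimH_setOf_inner_mem_range_ratCast_le {n : ℕ} {v : EuclideanSpace ℝ (Fin n)} (hv : v ≠ 0) :
    dimH {y | inner ℝ v y ∈ Set.range ((↑) : ℚ → ℝ)} ≤ (n - 1 : ℕ) := by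
  have hsub : {y | inner ℝ v y ∈ Set.range ((↑) : ℚ → ℝ)} ⊆
      ⋃ q : ℚ, (fun w => ((q : ℝ) / ‖v‖ ^ 2) • v + w) '' ((ℝ ∙ v)ᗮ : Set _) := by
    rintro y ⟨q, hq⟩
    have h : ‖v‖ ^ 2 ≠ 0 := by simpa using hv
    refine Set.mem_iUnion.2 ⟨q, y - ((q : ℝ) / ‖v‖ ^ 2) • v, ?_, by simp⟩
    rw [SetLike.mem_coe, Submodule.mem_orthogonal_singleton_iff_inner_right, inner_sub_right, ← hq,
      inner_smul_right, real_inner_self_eq_norm_sq, div_mul_cancel₀ _ h, sub_self]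
  refine (dimH_mono hsub).trans ?_
  rw [dimH_iUnion]
  refine iSup_le fun q => ?_
  rw [(isometry_add_left _).dimH_image, dimH_submodule]
  have h := Submodule.finrank_add_finrank_orthogonal (ℝ ∙ v)
  rw [finrank_span_singleton hv, finrank_euclideanSpace_fin] at h
  norm_cast
  omega

theorem dense_setOf_add_exp_mul_mem_range_ratCast (a : ℝ) {c : ℝ} (hc : 0 < c) :
    Dense {r : ℝ | a + Real.exp r * c ∈ Set.range ((↑) : ℚ → ℝ)} := by
  refine dense_of_exists_between fun r r' hr => ?_
  obtain ⟨q, hq1, hq2⟩ := exists_rat_btwn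
    (add_lt_add_right (mul_lt_mul_of_pos_right (Real.exp_lt_exp.2 hr) hc) a)
  have hpos : 0 < (q - a) / c := div_pos (by nlinarith [Real.exp_pos r]) hc
  have he : Real.exp (Real.log ((q - a) / c)) = (q - a) / c := Real.exp_log hpos
  refine ⟨Real.log ((q - a) / c), ⟨q, ?_⟩, ?_, ?_⟩
  · rw [he, div_mul_cancel₀ _ hc.ne']; ring
  · rw [Real.lt_log_iff_exp_lt hpos, lt_div_iff₀ hc]; linarith
  · rw [Real.log_lt_iff_lt_exp hpos, div_lt_iff₀ hc]; linarith

/-- Pairing with `v i` is constant on the `i`-th flat, with value `‖v i‖ ^ 2 ≠ 0`. A scaled copy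
thus lies in a hyperplane whose level is rational for a dense set of scales. Writing the scale as an
exponential lets the parameter range over all of `ℝ`. -/
theorem CoveredByFlatsMissingZero.exists_containsScaledCopies {n k : ℕ}
    {S : Set (EuclideanSpace ℝ (Fin n))} (hS : CoveredByFlatsMissingZero k S) :
    ∃ A, MeasurableSet A ∧ dimH A ≤ (n - 1 : ℕ) ∧ ContainsScaledCopies S A := by
  obtain ⟨ι, _, L, v, -, hv0, hvL, hSV⟩ := hS.exists_family
  obtain ⟨A, hA, hdA, h⟩ := exists_measurableSet_dimH_le_forall_exists_mapsTo
    (f := fun (x : EuclideanSpace ℝ (Fin n)) (r : ℝ) s => x + Real.exp r • s)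
    (fun x => by fun_prop) (fun i => isSigmaCompact_setOf_sub_mem (L i) (v i))
    (fun i => dimH_setOf_inner_mem_range_ratCast_le (hv0 i)) (fun x i => by
      refine (dense_setOf_add_exp_mul_mem_range_ratCast (inner ℝ (v i) x)
        (c := ‖v i‖ ^ 2) (by have := norm_pos_iff.2 (hv0 i); positivity)).mono ?_
      intro r hr s hs
      have : inner ℝ (v i) s = ‖v i‖ ^ 2 := by
        rw [← sub_add_cancel s (v i), inner_add_right,
          Submodule.inner_left_of_mem_orthogonal hs (hvL i), real_inner_self_eq_norm_sq, zero_add]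
      show inner ℝ (v i) (x + Real.exp r • s) ∈ Set.range ((↑) : ℚ → ℝ)
      rw [inner_add_right, inner_smul_right, this]
      exact hr)
  refine ⟨A, hA, hdA, fun x => ?_⟩
  obtain ⟨r, hr⟩ := h x
  exact ⟨Real.exp r, Real.exp_pos r, (hr.mono_left hSV).image_subset⟩

theorem scaledCopy_rotate {n : ℕ} (x : EuclideanSpace ℝ (Fin n)) (r : ℝ)
    (T : Matrix.specialOrthogonalGroup (Fin n) ℝ) (S : Set (EuclideanSpace ℝ (Fin n))) :
    scaledCopy x r (rotate T S) = (fun s => x + r • specialOrthogonalIsometry T s) '' S := by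
  rw [scaledCopy, rotate, Set.image_image]
  rfl

theorem CoveredByFlatsMissingZero.exists_containsScaledRotatedCopies {n k : ℕ}
    {S : Set (EuclideanSpace ℝ (Fin n))} (hS : CoveredByFlatsMissingZero k S) :
    ∃ A, MeasurableSet A ∧ dimH A ≤ k ∧ ContainsScaledRotatedCopies S A := by
  obtain ⟨ι, _, L, v, hL, hv0, hvL, hSV⟩ := hS.exists_family
  choose F hF hd using fun i => exists_dense_similarity_mapsTo (L i) (hv0 i) (hvL i)
  obtain ⟨A, hA, hdA, h⟩ := exists_measurableSet_dimH_le_forall_exists_mapsTo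
    (f := fun (x : EuclideanSpace ℝ (Fin n)) (q : ℝ × Matrix.specialOrthogonalGroup (Fin n) ℝ) s =>
      x + Real.exp q.1 • specialOrthogonalIsometry q.2 s)
    (fun x => by
      have h := continuous_specialOrthogonalIsometry (n := n)
      fun_prop) (fun i => isSigmaCompact_setOf_sub_mem (L i) (v i))
    (d := k) (fun i => (hF i).trans_eq (by rw [hL])) (fun x i => hd i x)
  refine ⟨A, hA, hdA, fun x => ?_⟩
  obtain ⟨q, hq⟩ := h x
  refine ⟨Real.exp q.1, Real.exp_pos _, q.2, ?_⟩
  rw [scaledCopy_rotate]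
  exact (hq.mono_left hSV).image_subset

/-- The target built from `L i ⊔ ℝ ∙ v i` serves all radii at once, because this span contains every
multiple of `v i`. The pair of centre and radius can therefore play the role of the centre in the
category argument. -/
theorem CoveredByFlatsMissingZero.exists_containsRotatedCopiesOfEverySize {n k : ℕ}
    {S : Set (EuclideanSpace ℝ (Fin n))} (hS : CoveredByFlatsMissingZero k S) :
    ∃ A, MeasurableSet A ∧ dimH A ≤ (k + 1 : ℕ) ∧ ContainsRotatedCopiesOfEverySize S A := by
  obtain ⟨ι, _, L, v, hL, hv0, hvL, hSV⟩ := hS.exists_family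
  choose F hF hd using fun i =>
    exists_dense_rotation_mapsTo (le_sup_left : L i ≤ L i ⊔ ℝ ∙ v i)
  obtain ⟨A, hA, hdA, h⟩ := exists_measurableSet_dimH_le_forall_exists_mapsTo
    (f := fun (z : EuclideanSpace ℝ (Fin n) × Set.Ioi (0 : ℝ))
      (q : Matrix.specialOrthogonalGroup (Fin n) ℝ) s =>
      z.1 + (z.2 : ℝ) • specialOrthogonalIsometry q s)
    (fun z => by
      have h := continuous_specialOrthogonalIsometry (n := n)
      fun_prop) (fun i => isSigmaCompact_setOf_sub_mem (L i) (v i))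
    (F := F) (d := (k + 1 : ℕ)) (fun i => (hF i).trans (by
      have := Submodule.finrank_add_le_finrank_add_finrank (L i) (ℝ ∙ v i)
      rw [hL, finrank_span_singleton (hv0 i)] at this
      exact_mod_cast this)) (fun z i => by
      have hz : 0 < (z.2 : ℝ) := z.2.2
      refine (hd i z.1 ((z.2 : ℝ) • v i) (Submodule.smul_mem _ _ (Submodule.mem_sup_right
        (Submodule.mem_span_singleton_self _))) (smul_ne_zero hz.ne' (hv0 i))
        (Submodule.smul_mem _ _ (hvL i))).mono fun q hq s hs => ?_
      have := hq (x := (z.2 : ℝ) • s) (by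
        show _ - _ ∈ L i
        rw [← smul_sub]
        exact Submodule.smul_mem _ _ hs)
      simpa only [map_smul] using this)
  refine ⟨A, hA, hdA, fun x r hr => ?_⟩
  obtain ⟨q, hq⟩ := h (x, ⟨r, hr⟩)
  refine ⟨q, ?_⟩
  rw [scaledCopy_rotate]
  exact (hq.mono_left hSV).image_subset

/-! ### Elementary lower bounds. -/

theorem CoveredByFlatsMissingZero.zero_notMem {n k : ℕ} {S : Set (EuclideanSpace ℝ (Fin n))}
    (hS : CoveredByFlatsMissingZero k S) : (0 : EuclideanSpace ℝ (Fin n)) ∉ S := by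
  obtain ⟨𝒱, -, h𝒱, hS⟩ := hS
  intro h
  obtain ⟨V, hV, h0⟩ := Set.mem_iUnion₂.1 (hS h)
  exact (h𝒱 V hV).2.2 h0

/-- For `x ⊥ s`, the point `x + r • s` of `A` projects to `x` whatever the scale `r` is, so the
projection of `A` covers a hyperplane. -/
theorem ContainsScaledCopies.le_dimH {n : ℕ} {S A : Set (EuclideanSpace ℝ (Fin n))}
    (h : ContainsScaledCopies S A) {s : EuclideanSpace ℝ (Fin n)} (hs : s ∈ S) (hs0 : s ≠ 0) :
    ((n - 1 : ℕ) : ℝ≥0∞) ≤ dimH A := by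
  have hfin := Submodule.finrank_add_finrank_orthogonal (ℝ ∙ s)
  rw [finrank_span_singleton hs0, finrank_euclideanSpace_fin] at hfin
  have hsub : ((ℝ ∙ s)ᗮ : Set _) ⊆ (ℝ ∙ s)ᗮ.starProjection '' A := by
    intro x hx
    obtain ⟨r, -, hr⟩ := h x
    refine ⟨x + r • s, hr ⟨s, hs, rfl⟩, ?_⟩
    rw [map_add, Submodule.starProjection_eq_self_iff.2 hx, map_smul,
      Submodule.starProjection_orthogonal_apply_eq_zero (Submodule.mem_span_singleton_self s)]
    simp
  have hlip := (ℝ ∙ s)ᗮ.starProjection.lipschitz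
  calc ((n - 1 : ℕ) : ℝ≥0∞) = Module.finrank ℝ ((ℝ ∙ s)ᗮ : Submodule ℝ _) := by
        norm_cast; omega
    _ = dimH ((ℝ ∙ s)ᗮ : Set _) := (dimH_submodule _).symm
    _ ≤ _ := dimH_mono hsub
    _ ≤ dimH A := hlip.dimH_image_le A

theorem dimH_le_dimH_scaledCopy_rotate {n : ℕ} (x : EuclideanSpace ℝ (Fin n)) {r : ℝ} (hr : 0 < r)
    (T : Matrix.specialOrthogonalGroup (Fin n) ℝ) (S : Set (EuclideanSpace ℝ (Fin n))) :
    dimH S ≤ dimH (scaledCopy x r (rotate T S)) := by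
  rw [scaledCopy_rotate]
  have : AntilipschitzWith r⁻¹.toNNReal (fun s => x + r • specialOrthogonalIsometry T s) := by
    refine AntilipschitzWith.of_le_mul_dist fun a b => ?_
    rw [Real.coe_toNNReal _ (by positivity), dist_add_left, dist_smul₀,
      LinearIsometryEquiv.dist_map, Real.norm_of_nonneg hr.le, inv_mul_cancel_left₀ hr.ne']
  exact this.le_dimH_image S

/-! ### Counting separated points near flats. -/

theorem OrthonormalBasis.volume_setOf_abs_repr_sub_le {n : ℕ} {ι : Type*} [Fintype ι]
    (b : OrthonormalBasis ι ℝ (EuclideanSpace ℝ (Fin n))) (c : EuclideanSpace ℝ (Fin n))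
    (w : ι → ℝ) :
    volume {y | ∀ i, |b.repr (y - c) i| ≤ w i} = ∏ i, ENNReal.ofReal (2 * w i) := by
  have h := (PiLp.volume_preserving_ofLp ι).comp b.measurePreserving_repr
  have hset : {y | ∀ i, |b.repr (y - c) i| ≤ w i} = (fun y => WithLp.ofLp (b.repr y)) ⁻¹'
      Set.Icc (fun i => b.repr c i - w i) (fun i => b.repr c i + w i) := by
    ext y
    simp only [Set.mem_ofPred_eq, Set.mem_preimage, Set.mem_Icc, Pi.le_def, ← forall_and, map_sub,
      PiLp.sub_apply, abs_le]
    refine forall_congr' fun i => ?_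
    constructor <;> rintro ⟨h1, h2⟩ <;> constructor <;> linarith
  rw [hset]
  have := h.measure_preimage (s := Set.Icc (fun i => b.repr c i - w i) (fun i => b.repr c i + w i))
    measurableSet_Icc.nullMeasurableSet
  simp only [Function.comp_def] at this
  rw [this, Real.volume_Icc_pi]
  refine Finset.prod_congr rfl fun i _ => ?_
  congr 1; ring

/-- A volume bound for the number of `δ`-separated points in a box. -/
theorem card_mul_volume_ball_le_of_separated {n : ℕ} {ι : Type*} [Fintype ι]
    (b : OrthonormalBasis ι ℝ (EuclideanSpace ℝ (Fin n))) (c : EuclideanSpace ℝ (Fin n))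
    (w : ι → ℝ) {δ : ℝ} (G : Finset (EuclideanSpace ℝ (Fin n)))
    (hsep : ∀ p ∈ G, ∀ q ∈ G, p ≠ q → δ ≤ dist p q) (hG : ∀ p ∈ G, ∀ i, |b.repr (p - c) i| ≤ w i) :
    (G.card : ℝ≥0∞) * volume (Metric.ball (0 : EuclideanSpace ℝ (Fin n)) (δ / 2)) ≤
      ∏ i, ENNReal.ofReal (2 * (w i + δ / 2)) := by
  rw [← b.volume_setOf_abs_repr_sub_le c]
  have hdisj : (G : Set (EuclideanSpace ℝ (Fin n))).PairwiseDisjoint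
      fun p => Metric.ball p (δ / 2) := fun p hp q hq hpq =>
    Metric.ball_disjoint_ball (by linarith [hsep p hp q hq hpq])
  calc (G.card : ℝ≥0∞) * volume (Metric.ball (0 : EuclideanSpace ℝ (Fin n)) (δ / 2))
      = ∑ p ∈ G, volume (Metric.ball p (δ / 2)) := by
        rw [Finset.sum_congr rfl fun p _ => Measure.addHaar_ball_center volume p (δ / 2),
          Finset.sum_const, nsmul_eq_mul]
    _ = volume (⋃ p ∈ G, Metric.ball p (δ / 2)) :=
        (measure_biUnion_finset hdisj fun p _ => measurableSet_ball).symm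
    _ ≤ _ := by
        refine measure_mono (Set.iUnion₂_subset fun p hp y hy i => ?_)
        have h1 : |b.repr (y - p) i| ≤ δ / 2 := by
          have h2 := PiLp.norm_apply_le (b.repr (y - p)) i
          rw [LinearIsometryEquiv.norm_map, ← dist_eq_norm] at h2
          exact h2.trans (Metric.mem_ball.1 hy).le
        have h3 : b.repr (y - c) i = b.repr (p - c) i + b.repr (y - p) i := by
          rw [← PiLp.add_apply, ← map_add, add_comm, sub_add_sub_cancel]
        rw [h3]
        exact (abs_add_le _ _).trans (add_le_add (hG p hp i) h1)

/-- Volume packing in a box with half-widths `w j` along `e j` and `R` in the remaining directions.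
A side enlarged by `δ / 2` at both ends, measured in units of `δ / 2`, gives the factor `4 * w j / δ
+ 2`. -/
theorem exists_card_le_of_abs_inner_le (n : ℕ) : ∃ C : ℝ, 0 < C ∧
    ∀ (κ : Type) [Fintype κ] (e : κ → EuclideanSpace ℝ (Fin n)) (_ : Orthonormal ℝ e) (w : κ → ℝ)
      (c : EuclideanSpace ℝ (Fin n)) (R δ : ℝ) (_ : 0 < δ) (_ : 0 ≤ R) (_ : ∀ j, 0 ≤ w j)
      (G : Finset (EuclideanSpace ℝ (Fin n))) (_ : ∀ p ∈ G, ∀ q ∈ G, p ≠ q → δ ≤ dist p q)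
      (_ : ∀ p ∈ G, ∀ j, |inner ℝ (e j) (p - c)| ≤ w j) (_ : ∀ p ∈ G, ‖p - c‖ ≤ R),
      (G.card : ℝ) ≤ C * (∏ j, (4 * w j / δ + 2)) * (4 * R / δ + 2) ^ (n - Fintype.card κ) := by
  set β := volume (Metric.ball (0 : EuclideanSpace ℝ (Fin n)) 1) with hβ
  have hβ0 : β ≠ 0 := (Metric.measure_ball_pos _ _ one_pos).ne'
  have hβt : β ≠ ⊤ := measure_ball_lt_top.ne
  have hβr : 0 < β.toReal := ENNReal.toReal_pos hβ0 hβt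
  refine ⟨β.toReal⁻¹, by positivity, ?_⟩
  intro κ _ e he w c R δ hδ hR hw G hsep hin hnorm
  have hcard : Fintype.card κ ≤ n := by
    simpa using he.linearIndependent.fintype_card_le_finrank
  -- The zero vectors are placeholders: only the part of the family indexed by `κ` has to be
  -- orthonormal in order to extend to a basis.
  have hv : Orthonormal ℝ ((Set.range (Sum.inl : κ → κ ⊕ Fin (n - Fintype.card κ))).domRestrict
      (Sum.elim e fun _ => (0 : EuclideanSpace ℝ (Fin n)))) := by
    refine ⟨?_, ?_⟩
    · rintro ⟨_, i, rfl⟩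
      exact he.1 i
    · rintro ⟨_, i, rfl⟩ ⟨_, j, rfl⟩ hij
      exact he.2 fun h => hij (by rw [h])
  obtain ⟨b, hb⟩ := hv.exists_orthonormalBasis_extension_of_card_eq (by simp; omega)
  have key := card_mul_volume_ball_le_of_separated b c (Sum.elim w fun _ => R) G hsep (by
    rintro p hp (j | j)
    · rw [OrthonormalBasis.repr_apply_apply, hb _ ⟨j, rfl⟩]
      exact hin p hp j
    · have h2 := PiLp.norm_apply_le (b.repr (p - c)) (Sum.inr j)
      rw [LinearIsometryEquiv.norm_map] at h2
      exact h2.trans (hnorm p hp))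
  rw [Measure.addHaar_ball_of_pos _ _ (by positivity), finrank_euclideanSpace_fin, ← hβ,
    ← ENNReal.ofReal_prod_of_nonneg (by
      rintro (j | j) -
      · have := hw j; simp only [Sum.elim_inl]; positivity
      · simp only [Sum.elim_inr]; positivity)] at key
  rw [← ENNReal.ofReal_toReal hβt, ← ENNReal.ofReal_mul (by positivity), ← ENNReal.ofReal_natCast,
    ← ENNReal.ofReal_mul (by positivity), ENNReal.ofReal_le_ofReal_iff (by
      refine Finset.prod_nonneg ?_
      rintro (j | j) -
      · have := hw j; simp only [Sum.elim_inl]; positivity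
      · simp only [Sum.elim_inr]; positivity)] at key
  rw [Fintype.prod_sum_type] at key
  simp only [Sum.elim_inl, Sum.elim_inr, Finset.prod_const, Finset.card_univ, Fintype.card_fin]
    at key
  have hpow : (δ / 2) ^ n = (∏ _j : κ, (δ / 2)) * (δ / 2) ^ (n - Fintype.card κ) := by
    rw [Finset.prod_const, Finset.card_univ, ← pow_add]; congr 1; omega
  have hfac : (∏ j, 2 * (w j + δ / 2)) * (2 * (R + δ / 2)) ^ (n - Fintype.card κ) =
      (∏ j, (4 * w j / δ + 2)) * (4 * R / δ + 2) ^ (n - Fintype.card κ) * (δ / 2) ^ n := by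
    have h1 : ∀ r : ℝ, 2 * (r + δ / 2) = (4 * r / δ + 2) * (δ / 2) := fun r => by field_simp; ring
    rw [hpow]
    simp only [h1, Finset.prod_mul_distrib, mul_pow]
    ring
  rw [hfac] at key
  have hδn : 0 < (δ / 2) ^ n := by positivity
  have key2 : (G.card : ℝ) * β.toReal ≤
      (∏ j, (4 * w j / δ + 2)) * (4 * R / δ + 2) ^ (n - Fintype.card κ) := by
    refine le_of_mul_le_mul_right ?_ hδn
    linarith
  rw [mul_assoc, inv_mul_eq_div, le_div_iff₀ hβr]
  exact key2

/-- Separated points near a `k`-flat, in a bounded region. -/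
theorem exists_card_mul_pow_le_of_near_flat (n k : ℕ) {R : ℝ} (hR : 0 ≤ R) : ∃ C : ℝ, 0 < C ∧
    ∀ (L : Submodule ℝ (EuclideanSpace ℝ (Fin n))) (_ : Module.finrank ℝ L = k)
      (c : EuclideanSpace ℝ (Fin n)) (δ : ℝ) (_ : 0 < δ) (_ : δ ≤ 1)
      (G : Finset (EuclideanSpace ℝ (Fin n))) (_ : ∀ p ∈ G, ∀ q ∈ G, p ≠ q → δ ≤ dist p q)
      (_ : ∀ p ∈ G, ‖Lᗮ.starProjection (p - c)‖ ≤ 4 * δ) (_ : ∀ p ∈ G, ‖p - c‖ ≤ R),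
      (G.card : ℝ) * δ ^ k ≤ C := by
  obtain ⟨C, hC, h⟩ := exists_card_le_of_abs_inner_le n
  refine ⟨C * 18 ^ n * (4 * R + 2) ^ k, by positivity, ?_⟩
  intro L hL c δ hδ hδ1 G hsep hproj hnorm
  have hfin := Submodule.finrank_add_finrank_orthogonal L
  rw [hL, finrank_euclideanSpace_fin] at hfin
  have he : Orthonormal ℝ fun j => (stdOrthonormalBasis ℝ Lᗮ j : EuclideanSpace ℝ (Fin n)) :=
    (stdOrthonormalBasis ℝ Lᗮ).orthonormal.comp_linearIsometry Lᗮ.subtypeₗᵢ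
  have key := h _ _ he (fun _ => 4 * δ) c R δ hδ hR (fun _ => by positivity) G hsep (fun p hp j => by
    have h1 : inner ℝ (stdOrthonormalBasis ℝ Lᗮ j : EuclideanSpace ℝ (Fin n)) (p - c) =
        inner ℝ (stdOrthonormalBasis ℝ Lᗮ j : EuclideanSpace ℝ (Fin n))
          (Lᗮ.starProjection (p - c)) := by
      rw [← sub_eq_zero, ← inner_sub_right]
      exact Submodule.inner_right_of_mem_orthogonal (stdOrthonormalBasis ℝ Lᗮ j).2
        (Submodule.sub_starProjection_mem_orthogonal _)
    rw [h1]
    refine (abs_real_inner_le_norm _ _).trans ?_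
    rw [he.1 j, one_mul]
    exact hproj p hp) hnorm
  simp only [Finset.prod_const, Finset.card_univ, Fintype.card_fin] at key
  have hk : n - Module.finrank ℝ Lᗮ = k := by omega
  have h18 : 4 * (4 * δ) / δ + 2 = 18 := by field_simp; norm_num
  rw [hk, h18] at key
  have h2 : (4 * R / δ + 2) * δ ≤ 4 * R + 2 := by
    rw [add_mul, div_mul_cancel₀ _ hδ.ne']; linarith
  calc (G.card : ℝ) * δ ^ k
      ≤ C * 18 ^ Module.finrank ℝ Lᗮ * (4 * R / δ + 2) ^ k * δ ^ k := by gcongr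
    _ = C * 18 ^ Module.finrank ℝ Lᗮ * ((4 * R / δ + 2) * δ) ^ k := by rw [mul_pow]; ring
    _ ≤ C * 18 ^ n * (4 * R + 2) ^ k := by
        gcongr
        · norm_num
        · omega

/-- Separated points near a `k`-flat and in a slab orthogonal to some direction of the flat. -/
theorem exists_card_mul_pow_le_of_near_flat_of_slab (n k : ℕ) {R : ℝ} (hR : 0 ≤ R) :
    ∃ C : ℝ, 0 < C ∧
    ∀ (L : Submodule ℝ (EuclideanSpace ℝ (Fin n))) (_ : Module.finrank ℝ L = k)
      (c g : EuclideanSpace ℝ (Fin n)) (_ : g ∈ L) (_ : g ≠ 0) (δ t : ℝ) (_ : 0 < δ) (_ : δ ≤ 1)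
      (_ : 0 ≤ t)
      (G : Finset (EuclideanSpace ℝ (Fin n))) (_ : ∀ p ∈ G, ∀ q ∈ G, p ≠ q → δ ≤ dist p q)
      (_ : ∀ p ∈ G, ‖Lᗮ.starProjection (p - c)‖ ≤ 4 * δ)
      (_ : ∀ p ∈ G, |inner ℝ g (p - c)| ≤ t * δ) (_ : ∀ p ∈ G, ‖p - c‖ ≤ R),
      (G.card : ℝ) * δ ^ k ≤ C * (4 * t / ‖g‖ + 2) * δ := by
  obtain ⟨C, hC, h⟩ := exists_card_le_of_abs_inner_le n
  refine ⟨C * 18 ^ n * (4 * R + 2) ^ (k - 1), by positivity, ?_⟩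
  intro L hL c g hgL hg δ t hδ hδ1 ht G hsep hproj hslab hnorm
  have hg0 : 0 < ‖g‖ := norm_pos_iff.2 hg
  have hk1 : 1 ≤ k := by
    rw [← hL, Nat.one_le_iff_ne_zero, Ne, Submodule.finrank_eq_zero]
    rintro rfl
    exact hg ((Submodule.mem_bot ℝ).1 hgL)
  have hfin := Submodule.finrank_add_finrank_orthogonal L
  rw [hL, finrank_euclideanSpace_fin] at hfin
  have he0 : Orthonormal ℝ fun j => (stdOrthonormalBasis ℝ Lᗮ j : EuclideanSpace ℝ (Fin n)) :=
    (stdOrthonormalBasis ℝ Lᗮ).orthonormal.comp_linearIsometry Lᗮ.subtypeₗᵢ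
  have he : Orthonormal ℝ (Sum.elim
      (fun j => (stdOrthonormalBasis ℝ Lᗮ j : EuclideanSpace ℝ (Fin n)))
      (fun _ : Unit => ‖g‖⁻¹ • g)) := by
    have hperp : ∀ j, inner ℝ (stdOrthonormalBasis ℝ Lᗮ j : EuclideanSpace ℝ (Fin n)) g = 0 :=
      fun j => Submodule.inner_left_of_mem_orthogonal hgL (stdOrthonormalBasis ℝ Lᗮ j).2
    refine ⟨?_, ?_⟩
    · rintro (j | j)
      · exact he0.1 j
      · simp [norm_smul, hg0.ne']
    · rintro (i | i) (j | j) hij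
      · exact he0.2 fun h => hij (by rw [h])
      · simp [inner_smul_right, hperp]
      · simp only [Sum.elim_inr, Sum.elim_inl, inner_smul_left]
        rw [real_inner_comm, hperp, mul_zero]
      · exact absurd rfl hij
  have key := h _ _ he (Sum.elim (fun _ => 4 * δ) fun _ => t * δ / ‖g‖) c R δ hδ hR
    (by rintro (j | j) <;> simp only [Sum.elim_inl, Sum.elim_inr] <;> positivity) G hsep
    (by
      rintro p hp (j | j)
      · have h1 : inner ℝ (stdOrthonormalBasis ℝ Lᗮ j : EuclideanSpace ℝ (Fin n)) (p - c) =
            inner ℝ (stdOrthonormalBasis ℝ Lᗮ j : EuclideanSpace ℝ (Fin n))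
              (Lᗮ.starProjection (p - c)) := by
          rw [← sub_eq_zero, ← inner_sub_right]
          exact Submodule.inner_right_of_mem_orthogonal (stdOrthonormalBasis ℝ Lᗮ j).2
            (Submodule.sub_starProjection_mem_orthogonal _)
        simp only [Sum.elim_inl]
        rw [h1]
        refine (abs_real_inner_le_norm _ _).trans ?_
        rw [he0.1 j, one_mul]
        exact hproj p hp
      · simp only [Sum.elim_inr]
        rw [inner_smul_left, RCLike.conj_to_real, abs_mul, abs_of_pos (inv_pos.2 hg0),
          inv_mul_eq_div]
        gcongr
        exact hslab p hp) hnorm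
  simp only [Fintype.prod_sum_type, Sum.elim_inl, Sum.elim_inr, Finset.prod_const,
    Finset.card_univ, Fintype.card_fin, Fintype.card_sum, Fintype.card_unit, pow_one] at key
  have hk : n - (Module.finrank ℝ Lᗮ + 1) = k - 1 := by omega
  have h18 : 4 * (4 * δ) / δ + 2 = 18 := by field_simp; norm_num
  have ht' : 4 * (t * δ / ‖g‖) / δ = 4 * t / ‖g‖ := by field_simp
  rw [hk, h18, ht'] at key
  have h2 : (4 * R / δ + 2) * δ ≤ 4 * R + 2 := by
    rw [add_mul, div_mul_cancel₀ _ hδ.ne']; linarith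
  have hδk : δ ^ k = δ ^ (k - 1) * δ := by rw [← pow_succ]; congr 1; omega
  calc (G.card : ℝ) * δ ^ k
      ≤ C * (18 ^ Module.finrank ℝ Lᗮ * (4 * t / ‖g‖ + 2)) * (4 * R / δ + 2) ^ (k - 1) * δ ^ k := by
        gcongr
    _ = C * 18 ^ Module.finrank ℝ Lᗮ * ((4 * R / δ + 2) * δ) ^ (k - 1) * (4 * t / ‖g‖ + 2) * δ := by
        rw [mul_pow, hδk]; ring
    _ ≤ C * 18 ^ n * (4 * R + 2) ^ (k - 1) * (4 * t / ‖g‖ + 2) * δ := by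
        gcongr
        · norm_num
        · omega

/-- Two `k`-flats whose distances to a point `y` differ by `D` are both close to few points of a
separated set. -/
theorem exists_card_mul_pow_mul_le_of_near_two_flats (n k : ℕ) {R : ℝ} (hR : 0 < R) :
    ∃ C : ℝ, 0 < C ∧
    ∀ (L L' : Submodule ℝ (EuclideanSpace ℝ (Fin n))) (_ : Module.finrank ℝ L = k)
      (c c' y : EuclideanSpace ℝ (Fin n)) (δ : ℝ) (_ : 0 < δ) (_ : δ ≤ 1)
      (G : Finset (EuclideanSpace ℝ (Fin n))) (_ : ∀ p ∈ G, ∀ q ∈ G, p ≠ q → δ ≤ dist p q)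
      (_ : ∀ p ∈ G, ‖Lᗮ.starProjection (p - c)‖ ≤ 2 * δ)
      (_ : ∀ p ∈ G, ‖L'ᗮ.starProjection (p - c')‖ ≤ 2 * δ) (_ : ∀ p ∈ G, ‖p - y‖ ≤ R),
      (G.card : ℝ) * δ ^ k ≤ C ∧ (G.card : ℝ) * δ ^ k *
        (‖L'ᗮ.starProjection (y - c')‖ - ‖Lᗮ.starProjection (y - c)‖) ≤ C * δ := by
  obtain ⟨C₀, hC₀, h₀⟩ := exists_card_mul_pow_le_of_near_flat n k (R := 2 * R) (by positivity)
  obtain ⟨C₁, hC₁, h₁⟩ := exists_card_mul_pow_le_of_near_flat_of_slab n k (R := 2 * R)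
    (by positivity)
  refine ⟨16 * C₀ + 48 * R * C₁, by positivity, ?_⟩
  intro L L' hL c c' y δ hδ hδ1 G hsep hnear hnear' hy
  rcases G.eq_empty_or_nonempty with rfl | ⟨p₁, hp₁⟩
  · simp; constructor <;> positivity
  have hnear₁ : ∀ p ∈ G, ‖Lᗮ.starProjection (p - p₁)‖ ≤ 4 * δ := fun p hp => by
    rw [show p - p₁ = (p - c) - (p₁ - c) by abel, map_sub]
    exact (norm_sub_le _ _).trans (by linarith [hnear p hp, hnear p₁ hp₁])
  have hy₁ : ∀ p ∈ G, ‖p - p₁‖ ≤ 2 * R := fun p hp => by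
    rw [show p - p₁ = (p - y) - (p₁ - y) by abel]
    exact (norm_sub_le _ _).trans (by linarith [hy p hp, hy p₁ hp₁])
  have hcount := h₀ L hL p₁ δ hδ hδ1 G hsep hnear₁ hy₁
  have hR1 : 0 ≤ R * C₁ := by positivity
  refine ⟨by linarith, ?_⟩
  set D := ‖L'ᗮ.starProjection (y - c')‖ - ‖Lᗮ.starProjection (y - c)‖ with hD
  have hcard : 0 ≤ (G.card : ℝ) * δ ^ k := by positivity
  -- For small `D` the plain count suffices. Otherwise `4 * δ ≤ D / 4`, so errors of size `4 * δ`
  -- can be absorbed.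
  rcases le_or_gt D (16 * δ) with hDδ | hDδ
  · calc (G.card : ℝ) * δ ^ k * D ≤ (G.card : ℝ) * δ ^ k * (16 * δ) := by gcongr
      _ ≤ C₀ * (16 * δ) := by gcongr
      _ ≤ _ := by nlinarith
  have hD0 : 0 < D := by linarith
  -- The normal displacement from the second flat of the foot of `y` on the first. Its length is at
  -- least `D` by the triangle inequality.
  set u₀ := L'ᗮ.starProjection (y - Lᗮ.starProjection (y - c) - c') with hu₀
  have hu₀D : D ≤ ‖u₀‖ := by
    have h1 : u₀ = L'ᗮ.starProjection (y - c') -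
        L'ᗮ.starProjection (Lᗮ.starProjection (y - c)) := by
      rw [hu₀, ← map_sub]; congr 1; abel
    have h2 := norm_sub_norm_le (L'ᗮ.starProjection (y - c'))
      (L'ᗮ.starProjection (Lᗮ.starProjection (y - c)))
    have h3 := L'ᗮ.norm_starProjection_apply_le (Lᗮ.starProjection (y - c))
    rw [← h1] at h2
    linarith
  have hu₀0 : 0 < ‖u₀‖ := hD0.trans_le hu₀D
  set u := ‖u₀‖⁻¹ • u₀ with hu
  have hu1 : ‖u‖ = 1 := by rw [hu, norm_smul, norm_inv, norm_norm, inv_mul_cancel₀ hu₀0.ne']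
  have huL' : u ∈ L'ᗮ := Submodule.smul_mem _ _ (Submodule.starProjection_apply_mem _ _)
  have hinner : ∀ w, inner ℝ u w = inner ℝ u (L'ᗮ.starProjection w) := fun w => by
    rw [← Submodule.inner_starProjection_left_eq_right, Submodule.starProjection_eq_self_iff.2 huL']
  have hle : ∀ w, |inner ℝ u w| ≤ ‖w‖ := fun w =>
    (abs_real_inner_le_norm _ _).trans (by rw [hu1, one_mul])
  have hP : ∀ w, w - Lᗮ.starProjection w = L.starProjection w := fun w => by
    rw [Submodule.starProjection_orthogonal_val]; abel
  -- The gradient of the affine function `p ↦ ⟪u, p - c'⟫ - ⟪u, Lᗮ.starProjection (p - c)⟫`. This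
  -- function is at most `4 * δ` in absolute value on `G` and equals `‖u₀‖ ≥ D` at `y`, within `R`
  -- of `G`. So `‖g‖` is at least of order `D / R`, and `G` lies in a slab of thickness of order `δ
  -- / ‖g‖` orthogonal to `g ∈ L`.
  set g := L.starProjection u with hg
  have hginner : ∀ w, inner ℝ g w = inner ℝ u w - inner ℝ u (Lᗮ.starProjection w) := fun w => by
    rw [hg, Submodule.inner_starProjection_left_eq_right, ← hP, inner_sub_right]
  have hsmall : ∀ p ∈ G, |inner ℝ u (p - c') - inner ℝ u (Lᗮ.starProjection (p - c))| ≤ 4 * δ :=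
    fun p hp => by
    have h1 := hle (L'ᗮ.starProjection (p - c'))
    have h2 := hle (Lᗮ.starProjection (p - c))
    rw [← hinner] at h1
    exact (abs_sub _ _).trans (by linarith [hnear p hp, hnear' p hp])
  have hbig : inner ℝ u (y - c') - inner ℝ u (Lᗮ.starProjection (y - c)) = ‖u₀‖ := by
    rw [← inner_sub_right, show y - c' - Lᗮ.starProjection (y - c) =
      y - Lᗮ.starProjection (y - c) - c' by abel, hinner, ← hu₀, hu, inner_smul_left,
      real_inner_self_eq_norm_sq, RCLike.conj_to_real]
    field_simp
  have hslab : ∀ p ∈ G, |inner ℝ g (p - p₁)| ≤ 8 * δ := fun p hp => by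
    have : inner ℝ g (p - p₁) =
        (inner ℝ u (p - c') - inner ℝ u (Lᗮ.starProjection (p - c))) -
        (inner ℝ u (p₁ - c') - inner ℝ u (Lᗮ.starProjection (p₁ - c))) := by
      rw [hginner]
      simp only [map_sub, inner_sub_right]
      ring
    rw [this]
    exact (abs_sub _ _).trans (by linarith [hsmall p hp, hsmall p₁ hp₁])
  have hgR : 3 * D / 4 ≤ ‖g‖ * R := by
    have h1 : inner ℝ g (y - p₁) = ‖u₀‖ -
        (inner ℝ u (p₁ - c') - inner ℝ u (Lᗮ.starProjection (p₁ - c))) := by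
      rw [hginner, ← hbig]
      simp only [map_sub, inner_sub_right]
      ring
    have h2 := (abs_le.1 (hsmall p₁ hp₁)).2
    have h3 : inner ℝ g (y - p₁) ≤ ‖g‖ * R := (real_inner_le_norm _ _).trans (by
      gcongr
      rw [norm_sub_rev]
      exact hy p₁ hp₁)
    linarith
  have hg1 : ‖g‖ ≤ 1 := (L.norm_starProjection_apply_le u).trans hu1.le
  have hg0 : 0 < ‖g‖ := by
    by_contra! h
    nlinarith
  have key := h₁ L hL p₁ g (Submodule.starProjection_apply_mem _ _) (norm_pos_iff.1 hg0) δ 8 hδ hδ1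
    (by norm_num) G hsep hnear₁ hslab hy₁
  have hDg : D / ‖g‖ ≤ 4 * R / 3 := by rw [div_le_iff₀ hg0]; linarith
  have hDR : D ≤ 4 * R / 3 := by nlinarith
  calc (G.card : ℝ) * δ ^ k * D ≤ C₁ * (4 * 8 / ‖g‖ + 2) * δ * D := by gcongr
    _ = C₁ * δ * (32 * (D / ‖g‖) + 2 * D) := by ring
    _ ≤ C₁ * δ * (32 * (4 * R / 3) + 2 * (4 * R / 3)) := by gcongr
    _ ≤ (16 * C₀ + 48 * R * C₁) * δ := by nlinarith [mul_pos hC₀ hδ, mul_pos (mul_pos hR hC₁) hδ]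

/-! ### Shell volumes and the energy estimate. -/

theorem pow_sub_one_le {x : ℝ} (h1 : 1 ≤ x) (h3 : x ≤ 3) (n : ℕ) : x ^ n - 1 ≤ 3 ^ n * (x - 1) := by
  have key : 2 * (x ^ n - 1) ≤ (3 ^ n - 1) * (x - 1) := by
    induction n with
    | zero => simp
    | succ n ih =>
      have h : (1 : ℝ) ≤ 3 ^ n := one_le_pow₀ (by norm_num)
      calc 2 * (x ^ (n + 1) - 1) = x * (2 * (x ^ n - 1)) + 2 * (x - 1) := by ring
        _ ≤ x * ((3 ^ n - 1) * (x - 1)) + 2 * (x - 1) := by gcongr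
        _ ≤ 3 * ((3 ^ n - 1) * (x - 1)) + 2 * (x - 1) := by
          have : 0 ≤ ((3 : ℝ) ^ n - 1) * (x - 1) := mul_nonneg (by linarith) (by linarith)
          gcongr
        _ = (3 ^ (n + 1) - 1) * (x - 1) := by ring
  have : 0 ≤ (3 : ℝ) ^ n * (x - 1) := mul_nonneg (by positivity) (by linarith)
  nlinarith

/-- The part in a ball of a cylindrical shell around a flat has volume proportional to the thickness
of the shell. -/
theorem exists_volume_shell_le (n : ℕ) {ρ M : ℝ} (hρ : 0 < ρ) (hM : 0 < M) : ∃ C : ℝ, 0 < C ∧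
    ∀ (L : Submodule ℝ (EuclideanSpace ℝ (Fin n))) (c : EuclideanSpace ℝ (Fin n)) (_ : ‖c‖ ≤ M)
      (d : ℝ) (_ : 0 < d),
      volume ({y | |‖L.starProjection (y - c)‖ - ρ| < d} ∩ Metric.ball 0 1) ≤
        ENNReal.ofReal (C * d) := by
  set β := volume (Metric.ball (0 : EuclideanSpace ℝ (Fin n)) (M + 1)) with hβ
  have hβt : β ≠ ⊤ := measure_ball_lt_top.ne
  refine ⟨β.toReal * (3 ^ n * (4 / ρ)) + β.toReal * (2 / ρ) + 1, by positivity, ?_⟩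
  intro L c hc d hd
  rcases lt_or_ge (ρ / 2) d with hdρ | hdρ
  · calc volume ({y | |‖L.starProjection (y - c)‖ - ρ| < d} ∩ Metric.ball 0 1)
        ≤ β := measure_mono (Set.inter_subset_right.trans (Metric.ball_subset_ball (by linarith)))
      _ = ENNReal.ofReal β.toReal := (ENNReal.ofReal_toReal hβt).symm
      _ ≤ _ := by
        refine ENNReal.ofReal_le_ofReal ?_
        have h1 : 1 ≤ 2 / ρ * d := by rw [div_mul_eq_mul_div, le_div_iff₀ hρ]; linarith
        have h2 : 0 ≤ β.toReal * (3 ^ n * (4 / ρ)) * d := by positivity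
        have h3 := mul_le_mul_of_nonneg_left h1 (ENNReal.toReal_nonneg (a := β))
        nlinarith
  · let E : ℝ → Set (EuclideanSpace ℝ (Fin n)) := fun a =>
      {y | ‖L.starProjection (y - c)‖ < a} ∩ Metric.ball c (M + 1)
    have hEm : ∀ a, MeasurableSet (E a) := fun a => by
      refine MeasurableSet.inter (IsOpen.measurableSet ?_) measurableSet_ball
      exact isOpen_lt (by fun_prop) continuous_const
    have hEβ : ∀ a, volume (E a) ≤ β := fun a =>
      (measure_mono Set.inter_subset_right).trans_eq (Measure.addHaar_ball_center volume c _)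
    set lam := (ρ + d) / (ρ - d) with hlam
    have hρd : 0 < ρ - d := by linarith
    have hlam1 : 1 ≤ lam := by rw [hlam, le_div_iff₀ hρd]; linarith
    have hlam3 : lam ≤ 3 := by rw [hlam, div_le_iff₀ hρd]; linarith
    have hlamd : lam - 1 ≤ 4 / ρ * d := by
      rw [hlam, div_sub_one hρd.ne', div_mul_eq_mul_div, div_le_div_iff₀ hρd hρ]
      nlinarith
    -- The homothety with ratio `lam` about `c` carries the thin truncated cylinder `E (ρ - d)` onto
    -- a set containing the thick one, so the shell has at most `lam ^ n - 1` times the volume of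
    -- the thin one.
    have hscale : volume (E (ρ + d)) ≤ ENNReal.ofReal (lam ^ n) * volume (E (ρ - d)) := by
      have h := Measure.addHaar_image_homothety (volume : Measure (EuclideanSpace ℝ (Fin n))) c lam
        (E (ρ - d))
      rw [finrank_euclideanSpace_fin, abs_of_pos (by positivity)] at h
      rw [← h]
      refine measure_mono fun y hy => ?_
      have hlam0 : 0 < lam := by linarith
      refine ⟨c + lam⁻¹ • (y - c), ⟨?_, ?_⟩, ?_⟩
      · show ‖L.starProjection (c + lam⁻¹ • (y - c) - c)‖ < ρ - d
        rw [add_sub_cancel_left, map_smul, norm_smul, norm_inv, Real.norm_of_nonneg hlam0.le,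
          inv_mul_lt_iff₀ hlam0, hlam, div_mul_cancel₀ _ hρd.ne']
        exact hy.1
      · rw [Metric.mem_ball, dist_eq_norm, add_sub_cancel_left, norm_smul, norm_inv,
          Real.norm_of_nonneg hlam0.le, inv_mul_lt_iff₀ hlam0]
        have := mem_ball_iff_norm.1 hy.2
        nlinarith
      · simp [AffineMap.homothety_apply, hlam0.ne']
    have hsub : E (ρ - d) ⊆ E (ρ + d) := fun y hy =>
      ⟨lt_trans (b := ρ - d) hy.1 (by linarith), hy.2⟩
    calc volume ({y | |‖L.starProjection (y - c)‖ - ρ| < d} ∩ Metric.ball 0 1)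
        ≤ volume (E (ρ + d) \ E (ρ - d)) := by
          refine measure_mono fun y hy => ?_
          have hy1 : |‖L.starProjection (y - c)‖ - ρ| < d := hy.1
          refine ⟨⟨?_, ?_⟩, fun h => ?_⟩
          · have := (abs_lt.1 hy1).2
            show ‖_‖ < _
            linarith
          · have := Metric.mem_ball.1 hy.2
            rw [Metric.mem_ball]
            have h2 := dist_triangle y 0 c
            rw [dist_zero_left] at h2
            linarith
          · have := (abs_lt.1 hy1).1
            have h2 : ‖L.starProjection (y - c)‖ < ρ - d := h.1
            linarith
      _ = volume (E (ρ + d)) - volume (E (ρ - d)) :=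
          measure_sdiff hsub (hEm _).nullMeasurableSet ((hEβ _).trans_lt hβt.lt_top).ne
      _ ≤ ENNReal.ofReal (lam ^ n) * volume (E (ρ - d)) - volume (E (ρ - d)) :=
          tsub_le_tsub_right hscale _
      _ = ENNReal.ofReal (lam ^ n - 1) * volume (E (ρ - d)) := by
          rw [ENNReal.ofReal_sub _ zero_le_one, ENNReal.ofReal_one, ENNReal.sub_mul, one_mul]
          exact fun _ _ => ((hEβ _).trans_lt hβt.lt_top).ne
      _ ≤ ENNReal.ofReal (3 ^ n * (4 / ρ * d)) * ENNReal.ofReal β.toReal := by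
          rw [ENNReal.ofReal_toReal hβt]
          gcongr
          · exact (pow_sub_one_le hlam1 hlam3 n).trans (by gcongr)
          · exact hEβ _
      _ ≤ _ := by
          rw [← ENNReal.ofReal_mul (by positivity)]
          refine ENNReal.ofReal_le_ofReal ?_
          have : 0 ≤ β.toReal * (2 / ρ) * d := by positivity
          nlinarith

/-- With `δ = 2⁻ˡ`, decompose into the shells of thickness `2 ^ j * δ`, `j ≤ l`. On the first shell
containing `y`, `N y` is of order `2⁻ʲ / δ ^ k` at most, while the shell has volume of order `2 ^ j
* δ`. Each scale contributes equally, whence the factor `l + 1`. -/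
theorem exists_lintegral_le_of_mul_abs_sub_le (n k : ℕ) {ρ M C₁ : ℝ} (hρ : 0 < ρ) (hM : 0 < M)
    (hC₁ : 0 < C₁) : ∃ C : ℝ, 0 < C ∧
    ∀ (L : Submodule ℝ (EuclideanSpace ℝ (Fin n))) (c : EuclideanSpace ℝ (Fin n)) (_ : ‖c‖ ≤ M)
      (l : ℕ) (N : EuclideanSpace ℝ (Fin n) → ℝ)
      (_ : ∀ y, N y * ((1 / 2) ^ l) ^ k ≤ C₁)
      (_ : ∀ y, N y * ((1 / 2) ^ l) ^ k * |‖L.starProjection (y - c)‖ - ρ| ≤ C₁ * (1 / 2) ^ l),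
      ∫⁻ y in Metric.ball 0 1, ENNReal.ofReal (N y) ≤
        ENNReal.ofReal (C * (l + 1) * ((1 / 2) ^ l / ((1 / 2) ^ l) ^ k)) := by
  obtain ⟨C₂, hC₂, hshell⟩ := exists_volume_shell_le n hρ hM
  set β := volume (Metric.ball (0 : EuclideanSpace ℝ (Fin n)) 1) with hβ
  have hβt : β ≠ ⊤ := measure_ball_lt_top.ne
  refine ⟨2 * C₁ * C₂ + C₁ * β.toReal, by positivity, ?_⟩
  intro L c hc l N h1 h2
  set δ : ℝ := (1 / 2) ^ l with hδ
  have hδ0 : 0 < δ := by positivity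
  have hδl : 2 ^ l * δ = 1 := by rw [hδ, ← mul_pow]; norm_num
  let Sh : ℕ → Set (EuclideanSpace ℝ (Fin n)) := fun j =>
    {y | |‖L.starProjection (y - c)‖ - ρ| < 2 ^ j * δ}
  have hSh : ∀ j, MeasurableSet (Sh j) := fun j =>
    (isOpen_lt (by fun_prop) continuous_const).measurableSet
  have hpt : ∀ y, ENNReal.ofReal (N y) ≤
      (∑ j ∈ Finset.range (l + 1), (Sh j).indicator
        (fun _ => ENNReal.ofReal (2 * C₁ / δ ^ k * (1 / 2) ^ j)) y) +
      ENNReal.ofReal (C₁ * (δ / δ ^ k)) := by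
    intro y
    by_cases hex : ∃ j, j ≤ l ∧ y ∈ Sh j
    · classical
      refine le_trans ?_ le_self_add
      have hj := (Nat.find_spec hex)
      have hmin := fun {m} => Nat.find_min (m := m) hex
      set j := Nat.find hex
      refine le_trans ?_ (Finset.single_le_sum (fun _ _ => zero_le) (Finset.mem_range.2 (by omega)
        : j ∈ Finset.range (l + 1)))
      rw [Set.indicator_of_mem hj.2]
      refine ENNReal.ofReal_le_ofReal ?_
      rcases Nat.eq_zero_or_pos j with h0 | hpos
      · rw [h0, pow_zero, mul_one, le_div_iff₀ (by positivity)]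
        linarith [h1 y]
      · have hnot : ¬ (|‖L.starProjection (y - c)‖ - ρ| < 2 ^ (j - 1) * δ) := fun h =>
          hmin (Nat.sub_one_lt hpos.ne') ⟨by omega, h⟩
        push Not at hnot
        rcases le_or_gt (N y) 0 with hN | hN
        · exact hN.trans (by positivity)
        have h3 : N y * δ ^ k * (2 ^ (j - 1) * δ) ≤ C₁ * δ :=
          le_trans (by gcongr) (h2 y)
        have h4 : N y * δ ^ k * 2 ^ (j - 1) ≤ C₁ := by
          refine le_of_mul_le_mul_right ?_ hδ0
          linarith
        have h5 : (2 : ℝ) ^ j = 2 * 2 ^ (j - 1) := by rw [← pow_succ']; congr 1; omega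
        rw [one_div, inv_pow, div_mul_eq_mul_div, ← div_eq_mul_inv, div_div,
          le_div_iff₀ (by positivity), h5]
        linarith
    · refine le_trans ?_ le_add_self
      refine ENNReal.ofReal_le_ofReal ?_
      have hnot : ¬ (|‖L.starProjection (y - c)‖ - ρ| < 2 ^ l * δ) := fun h => hex ⟨l, le_rfl, h⟩
      rw [hδl] at hnot
      push Not at hnot
      rcases le_or_gt (N y) 0 with hN | hN
      · exact hN.trans (by positivity)
      rw [← mul_div_assoc, le_div_iff₀ (by positivity)]
      refine le_trans ?_ (h2 y)
      have : 0 ≤ N y * δ ^ k := by positivity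
      nlinarith
  calc ∫⁻ y in Metric.ball 0 1, ENNReal.ofReal (N y)
      ≤ ∫⁻ y in Metric.ball 0 1, ((∑ j ∈ Finset.range (l + 1), (Sh j).indicator
        (fun _ => ENNReal.ofReal (2 * C₁ / δ ^ k * (1 / 2) ^ j)) y) +
        ENNReal.ofReal (C₁ * (δ / δ ^ k))) := lintegral_mono hpt
    _ = (∑ j ∈ Finset.range (l + 1), ENNReal.ofReal (2 * C₁ / δ ^ k * (1 / 2) ^ j) *
          volume (Sh j ∩ Metric.ball 0 1)) + ENNReal.ofReal (C₁ * (δ / δ ^ k)) * β := by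
        rw [lintegral_add_right _ measurable_const, lintegral_finsetSum _ fun j _ =>
          measurable_const.indicator (hSh j), setLIntegral_const]
        congr 1
        refine Finset.sum_congr rfl fun j _ => ?_
        rw [lintegral_indicator_const (hSh j), Measure.restrict_apply (hSh j)]
    _ ≤ (∑ _j ∈ Finset.range (l + 1), ENNReal.ofReal (2 * C₁ * C₂ * (δ / δ ^ k))) +
          ENNReal.ofReal (C₁ * (δ / δ ^ k)) * ENNReal.ofReal β.toReal := by
        rw [ENNReal.ofReal_toReal hβt]
        gcongr with j _
        refine (mul_le_mul_right (hshell L c hc (2 ^ j * δ) (by positivity)) _).trans_eq ?_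
        rw [← ENNReal.ofReal_mul (by positivity)]
        congr 1
        rw [one_div, inv_pow]
        field_simp
    _ ≤ _ := by
        rw [Finset.sum_const, Finset.card_range, nsmul_eq_mul, ← ENNReal.ofReal_natCast,
          ← ENNReal.ofReal_mul (by positivity), ← ENNReal.ofReal_mul (by positivity),
          ← ENNReal.ofReal_add (by positivity) (by positivity)]
        refine ENNReal.ofReal_le_ofReal ?_
        push_cast
        have hpos : 0 ≤ C₁ * β.toReal * (δ / δ ^ k) * l := by positivity
        nlinarith

/-- The terms are `C * (l + 1) * θ ^ l` with `θ = 2 ^ (-(a + 1 - k)) < 1`: this is where the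
condition `a > k - 1` enters. -/
theorem tsum_ofReal_mul_geometric_ne_top {k : ℕ} {a C : ℝ} (ha : (k : ℝ) - 1 < a) :
    ∑' l : ℕ, ENNReal.ofReal (((1 / 2 : ℝ) ^ l) ^ a) *
      ENNReal.ofReal (C * (l + 1) * ((1 / 2) ^ l / ((1 / 2) ^ l) ^ k)) ≠ ⊤ := by
  set θ : ℝ := (1 / 2 : ℝ) ^ (a + 1 - k) with hθ
  have hθ0 : 0 < θ := by positivity
  have hθ1 : θ < 1 := Real.rpow_lt_one (by norm_num) (by norm_num) (by linarith)
  have hterm : ∀ l : ℕ, ENNReal.ofReal (((1 / 2 : ℝ) ^ l) ^ a) *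
      ENNReal.ofReal (C * (l + 1) * ((1 / 2) ^ l / ((1 / 2) ^ l) ^ k)) =
      ENNReal.ofReal (C * (l * θ ^ l + θ ^ l)) := by
    intro l
    rw [← ENNReal.ofReal_mul (by positivity)]
    congr 1
    have h : θ ^ l = ((1 / 2 : ℝ) ^ l) ^ a * ((1 / 2) ^ l / ((1 / 2) ^ l) ^ k) := by
      have hpos : (0 : ℝ) < (1 / 2) ^ l := by positivity
      rw [hθ, ← Real.rpow_natCast, ← Real.rpow_mul (by norm_num), mul_comm, Real.rpow_mul
        (by norm_num), Real.rpow_natCast, Real.rpow_sub hpos, Real.rpow_add hpos, Real.rpow_one,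
        Real.rpow_natCast, mul_div_assoc]
    rw [h]; ring
  simp only [hterm]
  refine Summable.tsum_ofReal_ne_top ?_
  refine ((Summable.add ?_ (summable_geometric_of_lt_one hθ0.le hθ1))).mul_left C
  have := summable_pow_mul_geometric_of_norm_lt_one (R := ℝ) 1 (r := θ)
    (by rwa [Real.norm_of_nonneg hθ0.le])
  simpa using this

/-- The key energy estimate: if `i ∈ I x` means that the point `p i` is `2 ^ (1 - l i)`-close to the
flat `c x + L x` at distance `ρ` from `x`, then the weighted energy of the incidences is bounded
independently of the configuration of points. -/
theorem exists_tsum_mul_volume_sq_le (n k : ℕ) {ρ R a : ℝ} (hρ : 0 < ρ) (hR : 0 < R)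
    (ha : (k : ℝ) - 1 < a) : ∃ K : ℝ≥0∞, K ≠ ⊤ ∧
    ∀ (ι : Type) [Countable ι] (l : ι → ℕ) (p : ι → EuclideanSpace ℝ (Fin n))
      (_ : ∀ i j, i ≠ j → l i = l j → (1 / 2) ^ l i ≤ dist (p i) (p j))
      (L : EuclideanSpace ℝ (Fin n) → Submodule ℝ (EuclideanSpace ℝ (Fin n)))
      (_ : ∀ x, Module.finrank ℝ (L x) = k) (c : EuclideanSpace ℝ (Fin n) → EuclideanSpace ℝ (Fin n))
      (_ : ∀ x, ‖c x - x‖ ≤ ρ) (_ : ∀ x, ‖(L x)ᗮ.starProjection (x - c x)‖ = ρ)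
      (I : EuclideanSpace ℝ (Fin n) → Finset ι) (_ : ∀ i, MeasurableSet {x | i ∈ I x})
      (_ : ∀ x, ∀ i ∈ I x, ‖(L x)ᗮ.starProjection (p i - c x)‖ ≤ 2 * (1 / 2) ^ l i)
      (_ : ∀ x, ∀ i ∈ I x, ‖p i - x‖ ≤ R),
      ∑' i, ENNReal.ofReal (((1 / 2 : ℝ) ^ l i) ^ a) *
        volume ({x | i ∈ I x} ∩ Metric.ball 0 1) ^ 2 ≤ K := by
  obtain ⟨C₁, hC₁, hcard⟩ := exists_card_mul_pow_mul_le_of_near_two_flats n k hR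
  obtain ⟨C, hC, hint⟩ := exists_lintegral_le_of_mul_abs_sub_le n k hρ (M := 1 + ρ) (by linarith)
    hC₁
  set β := volume (Metric.ball (0 : EuclideanSpace ℝ (Fin n)) 1) with hβ
  have hβt : β ≠ ⊤ := measure_ball_lt_top.ne
  set K := ∑' l : ℕ, ENNReal.ofReal (((1 / 2 : ℝ) ^ l) ^ a) *
      ENNReal.ofReal (C * (l + 1) * ((1 / 2) ^ l / ((1 / 2) ^ l) ^ k)) with hK
  refine ⟨K * β, ENNReal.mul_ne_top (tsum_ofReal_mul_geometric_ne_top ha) hβt, ?_⟩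
  intro ι _ l p hsep L hL c hc hcρ I hmeas hnear hnorm
  classical
  set μ := volume.restrict (Metric.ball (0 : EuclideanSpace ℝ (Fin n)) 1) with hμ
  set w : ι → ℝ≥0∞ := fun i => ENNReal.ofReal (((1 / 2 : ℝ) ^ l i) ^ a) with hw
  have hvol : ∀ i, volume ({x | i ∈ I x} ∩ Metric.ball 0 1) = μ {x | i ∈ I x} := fun i =>
    (Measure.restrict_apply (hmeas i)).symm
  -- The left side is the integral over `y` of the number of indices of scale `m` common to `I x`
  -- and `I y`, that is, of net points near both flats.
  have hscale : ∀ x ∈ Metric.ball (0 : EuclideanSpace ℝ (Fin n)) 1, ∀ m : ℕ,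
      ∑ i ∈ I x with l i = m, μ {y | i ∈ I y} ≤
        ENNReal.ofReal (C * (m + 1) * ((1 / 2) ^ m / ((1 / 2) ^ m) ^ k)) := by
    intro x hx m
    let G : EuclideanSpace ℝ (Fin n) → Finset ι := fun y => {i ∈ I x | l i = m ∧ i ∈ I y}
    have hcx : ‖c x‖ ≤ 1 + ρ := by
      have h1 := norm_add_le x (c x - x)
      rw [add_sub_cancel] at h1
      linarith [hc x, mem_ball_zero_iff.1 hx]
    have hinj : ∀ y, Set.InjOn p (G y : Set ι) := fun y i hi j hj hij => by
      by_contra hne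
      have h1 := hsep i j hne (by
        rw [(Finset.mem_filter.1 hi).2.1, (Finset.mem_filter.1 hj).2.1])
      rw [hij, dist_self] at h1
      exact absurd h1 (by push Not; positivity)
    have hGsep : ∀ y, ∀ q ∈ (G y).image p, ∀ q' ∈ (G y).image p, q ≠ q' →
        (1 / 2 : ℝ) ^ m ≤ dist q q' := by
      intro y q hq q' hq' hne
      obtain ⟨i, hi, rfl⟩ := Finset.mem_image.1 hq
      obtain ⟨j, hj, rfl⟩ := Finset.mem_image.1 hq'
      have hi' := (Finset.mem_filter.1 hi).2.1
      have hj' := (Finset.mem_filter.1 hj).2.1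
      have := hsep i j (fun h => hne (by rw [h])) (by rw [hi', hj'])
      rwa [hi'] at this
    have hGx : ∀ y, ∀ q ∈ (G y).image p,
        ‖(L x)ᗮ.starProjection (q - c x)‖ ≤ 2 * (1 / 2) ^ m := by
      intro y q hq
      obtain ⟨i, hi, rfl⟩ := Finset.mem_image.1 hq
      obtain ⟨h1, h2, h3⟩ := Finset.mem_filter.1 hi
      rw [← h2]; exact hnear x i h1
    have hGy : ∀ y, ∀ q ∈ (G y).image p,
        ‖(L y)ᗮ.starProjection (q - c y)‖ ≤ 2 * (1 / 2) ^ m := by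
      intro y q hq
      obtain ⟨i, hi, rfl⟩ := Finset.mem_image.1 hq
      obtain ⟨h1, h2, h3⟩ := Finset.mem_filter.1 hi
      rw [← h2]; exact hnear y i h3
    have hGR : ∀ y, ∀ q ∈ (G y).image p, ‖q - y‖ ≤ R := by
      intro y q hq
      obtain ⟨i, hi, rfl⟩ := Finset.mem_image.1 hq
      exact hnorm y i (Finset.mem_filter.1 hi).2.2
    have hδ0 : (0 : ℝ) < (1 / 2) ^ m := by positivity
    have hδ1 : (1 / 2 : ℝ) ^ m ≤ 1 := pow_le_one₀ (by norm_num) (by norm_num)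
    have hxy := fun y => hcard (L x) (L y) (hL x) (c x) (c y) y _ hδ0 hδ1 _ (hGsep y) (hGx y)
      (hGy y) (hGR y)
    -- The counting bound is one-sided in the difference of the distances; exchanging the two flats
    -- bounds its absolute value.
    have hyx := fun y => hcard (L y) (L x) (hL y) (c y) (c x) y _ hδ0 hδ1 _ (hGsep y) (hGy y)
      (hGx y) (hGR y)
    simp only [fun y => Finset.card_image_of_injOn (hinj y), hcρ] at hxy hyx
    have key := hint (L x)ᗮ (c x) hcx m (fun y => (G y).card) (fun y => (hxy y).1) (fun y => by
      rw [← abs_of_nonneg (by positivity : (0 : ℝ) ≤ (G y).card * ((1 / 2) ^ m) ^ k), ← abs_mul,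
        abs_le]
      constructor
      · linarith [(hxy y).2]
      · exact (hyx y).2)
    refine le_trans (le_of_eq ?_) key
    calc ∑ i ∈ I x with l i = m, μ {y | i ∈ I y}
        = ∑ i ∈ I x with l i = m, ∫⁻ y, {y | i ∈ I y}.indicator 1 y ∂μ :=
          Finset.sum_congr rfl fun i _ => (lintegral_indicator_one (hmeas i)).symm
      _ = ∫⁻ y, ∑ i ∈ I x with l i = m, {y | i ∈ I y}.indicator 1 y ∂μ :=
          (lintegral_finsetSum _ fun i _ => measurable_one.indicator (hmeas i)).symm
      _ = _ := by
          refine lintegral_congr fun y => ?_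
          simp only [Set.indicator_apply, Set.mem_ofPred_eq, Pi.one_apply]
          rw [Finset.sum_boole, ENNReal.ofReal_natCast, Finset.filter_filter]
  have hpt : ∀ x ∈ Metric.ball (0 : EuclideanSpace ℝ (Fin n)) 1,
      ∑' i, {x | i ∈ I x}.indicator (fun _ => w i * μ {x | i ∈ I x}) x ≤ K := by
    intro x hx
    have hzero : ∀ i, i ∉ I x →
        {x | i ∈ I x}.indicator (fun _ => w i * μ {x | i ∈ I x}) x = 0 := fun i hi =>
      Set.indicator_of_notMem (s := {x | i ∈ I x}) hi _
    rw [tsum_eq_sum hzero]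
    calc ∑ i ∈ I x, {x | i ∈ I x}.indicator (fun _ => w i * μ {x | i ∈ I x}) x
        = ∑ i ∈ I x, w i * μ {x | i ∈ I x} :=
          Finset.sum_congr rfl fun i hi => Set.indicator_of_mem (s := {x | i ∈ I x}) hi _
      _ = ∑ m ∈ (I x).image l, ∑ i ∈ I x with l i = m, w i * μ {x | i ∈ I x} :=
          (Finset.sum_fiberwise_of_maps_to (fun i hi => Finset.mem_image_of_mem l hi) _).symm
      _ ≤ ∑ m ∈ (I x).image l, ENNReal.ofReal (((1 / 2 : ℝ) ^ m) ^ a) *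
            ENNReal.ofReal (C * (m + 1) * ((1 / 2) ^ m / ((1 / 2) ^ m) ^ k)) := by
          refine Finset.sum_le_sum fun m _ => ?_
          refine le_trans (le_of_eq ?_) (mul_le_mul_right (hscale x hx m) _)
          rw [Finset.mul_sum]
          refine Finset.sum_congr rfl fun i hi => ?_
          rw [hw, ← (Finset.mem_filter.1 hi).2]
      _ ≤ K := ENNReal.sum_le_tsum _
  -- One factor of the squared volume becomes an integral over `x`; what remains is bounded for each
  -- fixed `x` by `hpt`.
  calc ∑' i, w i * volume ({x | i ∈ I x} ∩ Metric.ball 0 1) ^ 2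
      = ∑' i, ∫⁻ x, {x | i ∈ I x}.indicator (fun _ => w i * μ {x | i ∈ I x}) x ∂μ := by
        refine tsum_congr fun i => ?_
        rw [lintegral_indicator_const (hmeas i), hvol, sq, mul_assoc]
    _ = ∫⁻ x, ∑' i, {x | i ∈ I x}.indicator (fun _ => w i * μ {x | i ∈ I x}) x ∂μ :=
        (lintegral_tsum fun i => (measurable_const.indicator (hmeas i)).aemeasurable).symm
    _ ≤ ∫⁻ _x in Metric.ball (0 : EuclideanSpace ℝ (Fin n)) 1, K :=
        setLIntegral_mono measurable_const hpt
    _ = K * β := setLIntegral_const _ _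

/-! ### Dyadic covers and Hausdorff content. -/

theorem exists_separated_net {X : Type*} [MetricSpace X] (δ : ℝ) : ∃ D : Set X,
    (∀ p ∈ D, ∀ q ∈ D, p ≠ q → δ ≤ dist p q) ∧ ∀ x, 0 < δ → ∃ p ∈ D, dist x p < δ := by
  obtain ⟨D, hD⟩ := zorn_subset {D : Set X | ∀ p ∈ D, ∀ q ∈ D, p ≠ q → δ ≤ dist p q} (by
    intro c hc hchain
    refine ⟨⋃₀ c, ?_, fun s hs => Set.subset_sUnion_of_mem hs⟩
    rintro p ⟨s, hs, hp⟩ q ⟨s', hs', hq⟩ hpq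
    rcases hchain.total hs hs' with h | h
    · exact hc hs' p (h hp) q hq hpq
    · exact hc hs p hp q (h hq) hpq)
  refine ⟨D, hD.prop, fun x hδ => ?_⟩
  by_contra! hx
  have hmem : x ∈ D := hD.le_of_ge (y := insert x D) (by
    rintro p (rfl | hp) q (rfl | hq) hpq
    · exact absurd rfl hpq
    · exact hx q hq
    · rw [dist_comm]; exact hx p hp
    · exact hD.prop p hp q hq hpq) (Set.subset_insert x D) (Set.mem_insert x D)
  have := hx x hmem
  rw [dist_self] at this
  linarith

/-- Rounds a diameter up to a dyadic scale. No scale is comparable to diameter `0`, hence the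
tolerance `η`. -/
theorem exists_half_pow_near {r η : ℝ≥0∞} (hr : r ≤ 1) (hη : η ≠ 0) {t : ℝ} (ht : 0 < t) :
    ∃ l : ℕ, r ≤ ENNReal.ofReal ((1 / 2) ^ l) ∧
      ENNReal.ofReal (((1 / 2) ^ l) ^ t) ≤ ENNReal.ofReal (2 ^ t) * r ^ t + η := by
  rcases eq_or_ne r 0 with rfl | hr0
  · have hT : Filter.Tendsto (fun l : ℕ => ENNReal.ofReal (((1 / 2 : ℝ) ^ l) ^ t)) Filter.atTop
        (nhds 0) := by
      have h1 := tendsto_pow_atTop_nhds_zero_of_lt_one (r := (1 / 2 : ℝ)) (by norm_num) (by norm_num)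
      have h2 := ENNReal.tendsto_ofReal (h1.rpow_const (p := t) (Or.inr ht.le))
      rwa [Real.zero_rpow ht.ne', ENNReal.ofReal_zero] at h2
    obtain ⟨l, hl⟩ := (hT.eventually (gt_mem_nhds (pos_iff_ne_zero.2 hη))).exists
    exact ⟨l, zero_le, hl.le.trans le_add_self⟩
  · have hrt : r ≠ ⊤ := ne_top_of_le_ne_top ENNReal.one_ne_top hr
    have hpos : 0 < r.toReal := ENNReal.toReal_pos hr0 hrt
    obtain ⟨l, hl1, hl2⟩ := exists_nat_pow_near_of_lt_one hpos
      (ENNReal.toReal_le_of_le_ofReal zero_le_one (by simpa using hr))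
      (by norm_num : (0 : ℝ) < 1 / 2) (by norm_num)
    refine ⟨l, ?_, le_trans ?_ le_self_add⟩
    · rw [← ENNReal.ofReal_toReal hrt]
      exact ENNReal.ofReal_le_ofReal hl2
    · rw [← ENNReal.ofReal_toReal hrt, ENNReal.ofReal_rpow_of_pos hpos,
        ← ENNReal.ofReal_mul (by positivity), ← Real.mul_rpow (by norm_num) hpos.le]
      refine ENNReal.ofReal_le_ofReal (Real.rpow_le_rpow (by positivity) ?_ ht.le)
      rw [pow_succ] at hl1
      linarith

/-- Null sets for the Hausdorff measure can be covered economically by balls with dyadic radii whose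
centres are separated at each scale. -/
theorem exists_dyadic_cover {X : Type*} [MetricSpace X] [MeasurableSpace X] [BorelSpace X]
    {A : Set X} {t : ℝ} (ht : 0 < t) (hA : Measure.hausdorffMeasure t A = 0) {ε : ℝ≥0∞}
    (hε : ε ≠ 0) : ∃ J : Set (ℕ × X), J.Countable ∧
      (∀ i ∈ J, ∀ j ∈ J, i ≠ j → i.1 = j.1 → (1 / 2 : ℝ) ^ i.1 ≤ dist i.2 j.2) ∧
      A ⊆ ⋃ i ∈ J, Metric.ball i.2 (2 * (1 / 2) ^ i.1) ∧
      ∑' i : J, ENNReal.ofReal (((1 / 2 : ℝ) ^ i.1.1) ^ t) ≤ ε := by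
  choose D hDsep hD using fun l : ℕ => exists_separated_net (X := X) ((1 / 2) ^ l)
  have h2t : ENNReal.ofReal (2 ^ t) ≠ 0 := by
    rw [Ne, ENNReal.ofReal_eq_zero]; push Not; positivity
  set ε' := ε / 2 / ENNReal.ofReal (2 ^ t) with hε'
  have hε'0 : 0 < ε' := ENNReal.div_pos (ENNReal.half_pos hε).ne' ENNReal.ofReal_ne_top
  rw [Measure.hausdorffMeasure_apply] at hA
  have h1 := (iSup₂_le_iff.1 hA.le) 1 one_pos
  have h2 : _ < ε' := h1.trans_lt hε'0
  simp only [iInf_lt_iff] at h2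
  obtain ⟨U, hAU, hUd, hUs⟩ := h2
  obtain ⟨η, hη0, hηs⟩ := ENNReal.exists_pos_sum_of_countable (ENNReal.half_pos hε).ne' ℕ
  choose l hl1 hl2 using fun m => exists_half_pow_near (hUd m)
    (η := η m) (by simpa using (hη0 m).ne') ht
  choose u hu using fun m : {m // (U m).Nonempty} => m.2
  choose p hpD hp using fun m : {m // (U m).Nonempty} => hD (l m) (u m) (by positivity)
  -- Indexing by the pair of scale and centre identifies covering sets that were assigned the same
  -- ball, so that distinct indices of one scale have separated centres.
  let f : {m // (U m).Nonempty} → ℕ × X := fun m => (l m, p m)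
  refine ⟨Set.range f, Set.countable_range f, ?_, ?_, ?_⟩
  · rintro _ ⟨i, rfl⟩ _ ⟨j, rfl⟩ hij hl
    refine hDsep _ _ (hpD i) _ ?_ fun h => hij (Prod.ext hl h)
    have hl' : l i = l j := hl
    show p j ∈ D (l i)
    rw [hl']; exact hpD j
  · intro a ha
    obtain ⟨m, hm⟩ := Set.mem_iUnion.1 (hAU ha)
    let m' : {m // (U m).Nonempty} := ⟨m, a, hm⟩
    refine Set.mem_iUnion₂.2 ⟨f m', ⟨m', rfl⟩, ?_⟩
    have h3 : edist a (u m') ≤ ENNReal.ofReal ((1 / 2) ^ l m) :=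
      (Metric.edist_le_ediam_of_mem hm (hu m')).trans (hl1 m)
    rw [edist_dist, ENNReal.ofReal_le_ofReal_iff (by positivity)] at h3
    rw [Metric.mem_ball]
    have h4 : dist (u m') (p m') < (1 / 2) ^ l m := hp m'
    calc dist a (p m') ≤ dist a (u m') + dist (u m') (p m') := dist_triangle _ _ _
      _ < 2 * (1 / 2) ^ l m := by linarith
  · calc ∑' i : Set.range f, ENNReal.ofReal (((1 / 2 : ℝ) ^ i.1.1) ^ t)
        ≤ ∑' m : {m // (U m).Nonempty}, ENNReal.ofReal (((1 / 2 : ℝ) ^ l m) ^ t) :=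
          ENNReal.tsum_le_tsum_comp_of_surjective (f := Set.rangeFactorization f)
            Set.rangeFactorization_surjective
            fun i : Set.range f => ENNReal.ofReal (((1 / 2 : ℝ) ^ i.1.1) ^ t)
      _ ≤ ∑' m : {m // (U m).Nonempty}, (ENNReal.ofReal (2 ^ t) *
            (⨆ _ : (U m).Nonempty, Metric.ediam (U m) ^ t) + η m) := by
          refine ENNReal.tsum_le_tsum fun m => ?_
          rw [iSup_pos m.2]
          exact hl2 m
      _ ≤ ∑' m, (ENNReal.ofReal (2 ^ t) *
            (⨆ _ : (U m).Nonempty, Metric.ediam (U m) ^ t) + η m) :=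
          ENNReal.tsum_comp_le_tsum_of_injective Subtype.val_injective _
      _ ≤ ENNReal.ofReal (2 ^ t) * ε' + ε / 2 := by
          rw [ENNReal.tsum_add, ENNReal.tsum_mul_left]
          gcongr
      _ = ε := by
          rw [hε', ENNReal.mul_div_cancel h2t ENNReal.ofReal_ne_top, ENNReal.add_halves]

/-- Sets that are not null for the Hausdorff measure have positive Hausdorff content. -/
theorem exists_le_tsum_ediam_rpow {X : Type*} [MetricSpace X] [MeasurableSpace X] [BorelSpace X]
    {S : Set X} {s : ℝ} (hs : 0 ≤ s) (hS : Measure.hausdorffMeasure s S ≠ 0) :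
    ∃ c : ℝ≥0∞, 0 < c ∧ ∀ (κ : Type) [Countable κ] (U : κ → Set X), S ⊆ ⋃ j, U j →
      c ≤ ∑' j, Metric.ediam (U j) ^ s := by
  rw [Measure.hausdorffMeasure_apply, ← pos_iff_ne_zero, lt_iSup_iff] at hS
  obtain ⟨r, hr⟩ := hS
  rw [lt_iSup_iff] at hr
  obtain ⟨hr0, hr⟩ := hr
  -- Covers by sets of diameter at most `r` are controlled by the premeasure at scale `r`; in any
  -- other cover a single large set is enough. The truncation at `1` guards against `r = ⊤`.
  refine ⟨_, lt_min hr (ENNReal.rpow_pos (lt_min hr0 one_pos)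
    (min_lt_of_right_lt ENNReal.one_lt_top).ne : 0 < min r 1 ^ s), ?_⟩
  intro κ _ U hU
  by_cases hd : ∀ j, Metric.ediam (U j) ≤ r
  · refine (min_le_left _ _).trans ?_
    have := Encodable.ofCountable κ
    let m : Set X → ℝ≥0∞ := fun V => ⨆ _ : V.Nonempty, Metric.ediam V ^ s
    have hm : ∑' i, m (⋃ b ∈ Encodable.decode₂ κ i, U b) = ∑' b, m (U b) :=
      tsum_iUnion_decode₂ m (by simp [m]) U
    refine (iInf_le _ fun i => ⋃ b ∈ Encodable.decode₂ κ i, U b).trans ?_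
    refine (iInf_le _ (by rwa [Encodable.iUnion_decode₂])).trans ?_
    refine (iInf_le _ fun i => ?_).trans (hm.trans_le ?_)
    · exact Encodable.iUnion_decode₂_cases (C := fun V => Metric.ediam V ≤ r) (by simp) hd
    · exact ENNReal.tsum_le_tsum fun b => iSup_le fun _ => le_rfl
  · push Not at hd
    obtain ⟨j, hj⟩ := hd
    exact (min_le_right _ _).trans ((ENNReal.rpow_le_rpow ((min_le_left _ _).trans hj.le) hs).trans
      (ENNReal.le_tsum j))

/-! ### The lower bound `k + 1` for rotated copies. -/

/-- By the Lindelöf property countably many `O (e m)` cover the space, and `g x` is the first `e m`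
that works. Arbitrary choices made at each point can then be replaced by measurable ones that take
countably many values. -/
theorem exists_measurable_selection_of_isOpen {X : Type*} [TopologicalSpace X]
    [SecondCountableTopology X] [Nonempty X] [MeasurableSpace X] [OpensMeasurableSpace X]
    {O : X → Set X} (hO : ∀ x, IsOpen (O x)) (hx : ∀ x, x ∈ O x) :
    ∃ g : X → X, (∀ x, x ∈ O (g x)) ∧ ∀ P : X → Prop, MeasurableSet {x | P (g x)} := by
  classical
  obtain ⟨s, hs, hU⟩ := TopologicalSpace.countable_cover_nhds fun x => (hO x).mem_nhds (hx x)
  have hne : s.Nonempty := by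
    obtain ⟨x⟩ := ‹Nonempty X›
    obtain ⟨y, hy, -⟩ := Set.mem_iUnion₂.1 (hU.ge (Set.mem_univ x))
    exact ⟨y, hy⟩
  obtain ⟨e, rfl⟩ := hs.exists_eq_range hne
  have hex : ∀ x, ∃ m, x ∈ O (e m) := fun x => by
    obtain ⟨_, ⟨m, rfl⟩, hy⟩ := Set.mem_iUnion₂.1 (hU.ge (Set.mem_univ x))
    exact ⟨m, hy⟩
  refine ⟨fun x => e (Nat.find (hex x)), fun x => Nat.find_spec (hex x), fun P => ?_⟩
  exact measurable_find hex (fun m => (hO (e m)).measurableSet)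
    (MeasurableSet.of_discrete (s := {m | P (e m)}))

/-- Weighted arithmetic–geometric mean inequality, used with `X = r ^ t`, `Y = r ^ s`, `Z = r ^ (2 s
- t)`. If `Y * m` exceeds `lam * X`, then `(Y * m) * (lam * X) ≤ (Y * m) ^ 2 = X * Z * m ^ 2`, and
`X` cancels. -/
theorem ENNReal.mul_le_add_of_mul_self_eq {X Y Z m lam : ℝ≥0∞} (h : Y * Y = X * Z) (hX0 : X ≠ 0)
    (hX : X ≠ ⊤) (hlam : lam ≠ ⊤) (hlam0 : lam ≠ 0) :
    Y * m ≤ lam * X + lam⁻¹ * (Z * m ^ 2) := by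
  rcases le_total (Y * m) (lam * X) with h1 | h1
  · exact h1.trans le_self_add
  · refine le_trans ?_ le_add_self
    have h2 : (Y * m) * (lam * X) ≤ (Z * m ^ 2) * X := by
      calc (Y * m) * (lam * X) ≤ (Y * m) * (Y * m) := by gcongr
        _ = (Y * Y) * m ^ 2 := by ring
        _ = (Z * m ^ 2) * X := by rw [h]; ring
    rw [← mul_assoc, ENNReal.mul_le_mul_iff_left hX0 hX] at h2
    rw [← ENNReal.div_eq_inv_mul, ENNReal.le_div_iff_mul_le (.inl hlam0) (.inl hlam)]
    exact h2

/-- Balls of radius `2 * 2⁻ˡ` have diameter at most `4 * 2⁻ˡ`, so those meeting `S` carry a fixed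
amount of content, and finitely many carry half of it. Finiteness is what makes the resulting
incidence condition open in the centre. -/
theorem exists_pos_forall_exists_finset_le {X : Type} [MetricSpace X] [MeasurableSpace X]
    [BorelSpace X] {S : Set X} {s : ℝ} (hs : 0 ≤ s) (hS : Measure.hausdorffMeasure s S ≠ 0) :
    ∃ c : ℝ≥0∞, 0 < c ∧ c ≠ ⊤ ∧ ∀ (ι : Type) [Countable ι] (l : ι → ℕ) (p : ι → X),
      S ⊆ ⋃ i, Metric.ball (p i) (2 * (1 / 2) ^ l i) → ∃ I : Finset ι,
        (∀ i ∈ I, ∃ a ∈ S, a ∈ Metric.ball (p i) (2 * (1 / 2) ^ l i)) ∧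
        c ≤ ∑ i ∈ I, ENNReal.ofReal (((1 / 2 : ℝ) ^ l i) ^ s) := by
  obtain ⟨c, hc, h⟩ := exists_le_tsum_ediam_rpow hs hS
  have h4 : (0 : ℝ≥0∞) < 4 ^ s := ENNReal.rpow_pos (by norm_num) (by norm_num)
  have h4t : (4 : ℝ≥0∞) ^ s ≠ ⊤ := ENNReal.rpow_ne_top_of_nonneg hs (by norm_num)
  have hc4 : 0 < min (c / 4 ^ s) 1 := lt_min (ENNReal.div_pos hc.ne' h4t) one_pos
  have hc4t : min (c / 4 ^ s) 1 ≠ ⊤ := (min_lt_of_right_lt ENNReal.one_lt_top).ne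
  refine ⟨min (c / 4 ^ s) 1 / 2, ENNReal.half_pos hc4.ne', (ENNReal.div_lt_top hc4t (by simp)).ne,
    ?_⟩
  intro ι _ l p hcov
  let U : {i // ∃ a ∈ S, a ∈ Metric.ball (p i) (2 * (1 / 2) ^ l i)} → Set X :=
    fun i => Metric.ball (p i) (2 * (1 / 2) ^ l i)
  have h1 := h _ U (by
    intro a ha
    obtain ⟨i, hi⟩ := Set.mem_iUnion.1 (hcov ha)
    exact Set.mem_iUnion.2 ⟨⟨i, a, ha, hi⟩, hi⟩)
  have h2 : c ≤ 4 ^ s * ∑' i : {i // ∃ a ∈ S, a ∈ Metric.ball (p i) (2 * (1 / 2) ^ l i)},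
      ENNReal.ofReal (((1 / 2 : ℝ) ^ l i) ^ s) := by
    refine h1.trans ?_
    rw [← ENNReal.tsum_mul_left]
    refine ENNReal.tsum_le_tsum fun i => ?_
    rw [← ENNReal.ofReal_rpow_of_pos (by positivity), ← ENNReal.mul_rpow_of_nonneg _ _ hs]
    refine ENNReal.rpow_le_rpow ?_ hs
    have h3 : Metric.ediam (U i) ≤ 2 * ENNReal.ofReal (2 * (1 / 2) ^ l i) := by
      have := Metric.ediam_eball_le (x := p i) (r := ENNReal.ofReal (2 * (1 / 2) ^ l i))
      rwa [Metric.eball_ofReal] at this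
    refine h3.trans_eq ?_
    rw [ENNReal.ofReal_mul (by norm_num), ← mul_assoc]
    congr 1
    norm_num
  have h3 : min (c / 4 ^ s) 1 / 2 <
      ∑' i : {i // ∃ a ∈ S, a ∈ Metric.ball (p i) (2 * (1 / 2) ^ l i)},
        ENNReal.ofReal (((1 / 2 : ℝ) ^ l i) ^ s) := by
    refine (ENNReal.half_lt_self hc4.ne' hc4t).trans_le ((min_le_left _ _).trans ?_)
    exact ENNReal.div_le_of_le_mul' h2
  rw [ENNReal.tsum_eq_iSup_sum, lt_iSup_iff] at h3
  obtain ⟨I, hI⟩ := h3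
  refine ⟨I.map (Function.Embedding.subtype _), fun i hi => ?_, ?_⟩
  · obtain ⟨j, -, rfl⟩ := Finset.mem_map.1 hi
    exact j.2
  · rw [Finset.sum_map]
    exact hI.le

/-- A set that contains a rotated copy, about every point, of a piece `S` of a `k`-flat missing the
origin is not null for the `t`-dimensional Hausdorff measure if `S` is not null for the
`s`-dimensional one and `t < 2 s - k + 1`. -/
theorem hausdorffMeasure_ne_zero_of_rotated_copies {n k : ℕ}
    {L : Submodule ℝ (EuclideanSpace ℝ (Fin n))} (hL : Module.finrank ℝ L = k)
    {v : EuclideanSpace ℝ (Fin n)} (hv : v ≠ 0) (hvL : v ∈ Lᗮ) {R s t : ℝ} (hR : 0 ≤ R)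
    (hs : 0 ≤ s) (ht : 0 < t) (hst : (k : ℝ) - 1 < 2 * s - t)
    {S A : Set (EuclideanSpace ℝ (Fin n))} (hSL : ∀ a ∈ S, a - v ∈ L) (hSR : ∀ a ∈ S, ‖a‖ ≤ R)
    (hS : Measure.hausdorffMeasure s S ≠ 0)
    (T : EuclideanSpace ℝ (Fin n) → (EuclideanSpace ℝ (Fin n) ≃ₗᵢ[ℝ] EuclideanSpace ℝ (Fin n)))
    (hA : ∀ x, ∀ a ∈ S, x + T x a ∈ A) : Measure.hausdorffMeasure t A ≠ 0 := by
  intro hA0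
  obtain ⟨c, hc0, hct, hc⟩ := exists_pos_forall_exists_finset_le hs hS
  obtain ⟨K, hK, henergy⟩ := exists_tsum_mul_volume_sq_le n k (norm_pos_iff.2 hv)
    (R := R + 2) (by linarith) hst
  set β := volume (Metric.ball (0 : EuclideanSpace ℝ (Fin n)) 1) with hβ
  have hβ0 : 0 < β := Metric.measure_ball_pos _ _ one_pos
  have hβt : β ≠ ⊤ := measure_ball_lt_top.ne
  have hcβ : 0 < c * β := ENNReal.mul_pos hc0.ne' hβ0.ne'
  have hcβt : c * β ≠ ⊤ := ENNReal.mul_ne_top hct hβt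
  -- With this weight the energy term is at most `c * β / 4`. As `K` does not depend on the cover,
  -- the cover can be chosen afterwards with `∑ r ^ t` so small that the other term is too. The `+
  -- 1` keeps `lam` nonzero.
  set lam := (K + 1) / (c * β / 4) with hlam
  have hq0 : c * β / 4 ≠ 0 := (ENNReal.div_pos hcβ.ne' (by norm_num)).ne'
  have hqt : c * β / 4 ≠ ⊤ := (ENNReal.div_lt_top hcβt (by norm_num)).ne
  have hlam0 : lam ≠ 0 := (ENNReal.div_pos (by simp) hqt).ne'
  have hlamt : lam ≠ ⊤ := (ENNReal.div_lt_top (ENNReal.add_ne_top.2 ⟨hK, by simp⟩) hq0).ne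
  obtain ⟨J, hJc, hJsep, hAJ, hJt⟩ := exists_dyadic_cover ht hA0
    (ε := c * β / 4 / lam) (ENNReal.div_pos hq0 hlamt).ne'
  have := hJc.to_subtype
  have hex : ∀ x, ∃ I : Finset J,
      (∀ i ∈ I, ∃ a ∈ S, x + T x a ∈ Metric.ball i.1.2 (2 * (1 / 2) ^ i.1.1)) ∧
      c ≤ ∑ i ∈ I, ENNReal.ofReal (((1 / 2 : ℝ) ^ i.1.1) ^ s) := by
    intro x
    have hball : ∀ (i : J) a, a ∈ Metric.ball ((T x).symm (i.1.2 - x)) (2 * (1 / 2) ^ i.1.1) ↔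
        x + T x a ∈ Metric.ball i.1.2 (2 * (1 / 2) ^ i.1.1) := fun i a => by
      rw [Metric.mem_ball, Metric.mem_ball, ← (T x).dist_map, LinearIsometryEquiv.apply_symm_apply,
        ← dist_add_left x, add_sub_cancel]
    obtain ⟨I, hI, hIc⟩ := hc J (fun i => i.1.1) (fun i => (T x).symm (i.1.2 - x)) (by
      intro a ha
      obtain ⟨i, hi, hai⟩ := Set.mem_iUnion₂.1 (hAJ (hA x a ha))
      exact Set.mem_iUnion.2 ⟨⟨i, hi⟩, (hball ⟨i, hi⟩ a).2 hai⟩)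
    refine ⟨I, fun i hi => ?_, hIc⟩
    obtain ⟨a, ha, hai⟩ := hI i hi
    exact ⟨a, ha, (hball i a).1 hai⟩
  choose I hI hIc using hex
  -- The incidences in `I x` persist for centres near `x` with the rotation `T x` kept. So at `x`
  -- the rotation and the index set chosen at `g x` may be used: the copy about `x` need no longer
  -- lie in `A`, but it still meets the listed balls.
  obtain ⟨g, hg, hgm⟩ := exists_measurable_selection_of_isOpen
    (O := fun x => {x' | ∀ i ∈ I x, ∃ a ∈ S, x' + T x a ∈ Metric.ball i.1.2 (2 * (1 / 2) ^ i.1.1)})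
    (fun x => by
      have : {x' | ∀ i ∈ I x, ∃ a ∈ S, x' + T x a ∈ Metric.ball i.1.2 (2 * (1 / 2) ^ i.1.1)} =
          ⋂ i ∈ I x, ⋃ a ∈ S, {x' | x' + T x a ∈ Metric.ball i.1.2 (2 * (1 / 2) ^ i.1.1)} := by
        ext x'; simp
      rw [this]
      refine isOpen_biInter_finset fun i _ => isOpen_biUnion fun a _ => ?_
      exact Metric.isOpen_ball.preimage (continuous_id.add continuous_const))
    (fun x => hI x)
  have hbound := henergy J (fun i => i.1.1) (fun i => i.1.2)
    (fun i j hij hl => hJsep i i.2 j j.2 (fun h => hij (Subtype.ext h)) hl)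
    (fun x => L.map (T (g x)).toLinearEquiv.toLinearMap)
    (fun x => by rw [LinearEquiv.finrank_map_eq, hL]) (fun x => x + T (g x) v)
    (fun x => by simp) (fun x => by
      have hmem : T (g x) v ∈ (L.map (T (g x)).toLinearEquiv.toLinearMap)ᗮ := by
        rintro _ ⟨u, hu, rfl⟩
        exact ((T (g x)).inner_map_map u v).trans (hvL u hu)
      rw [sub_add_cancel_left, map_neg, norm_neg, Submodule.starProjection_eq_self_iff.2 hmem,
        LinearIsometryEquiv.norm_map])
    (fun x => I (g x)) (fun i => hgm fun x => i ∈ I x) (fun x i hi => by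
      obtain ⟨a, ha, hai⟩ := hg x i hi
      have h1 : i.1.2 - (x + T (g x) v) = (i.1.2 - (x + T (g x) a)) + T (g x) (a - v) := by
        rw [map_sub]; abel
      have hmem : T (g x) (a - v) ∈ L.map (T (g x)).toLinearEquiv.toLinearMap :=
        ⟨a - v, hSL a ha, rfl⟩
      rw [h1, map_add, Submodule.starProjection_orthogonal_apply_eq_zero hmem, add_zero]
      refine (Submodule.norm_starProjection_apply_le _ _).trans ?_
      rw [← dist_eq_norm, dist_comm]
      exact (Metric.mem_ball.1 hai).le) (fun x i hi => by
      obtain ⟨a, ha, hai⟩ := hg x i hi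
      have h1 : i.1.2 - x = (i.1.2 - (x + T (g x) a)) + T (g x) a := by abel
      have h2 : (1 / 2 : ℝ) ^ i.1.1 ≤ 1 := pow_le_one₀ (by norm_num) (by norm_num)
      rw [Metric.mem_ball, dist_comm, dist_eq_norm] at hai
      rw [h1]
      refine (norm_add_le _ _).trans ?_
      rw [LinearIsometryEquiv.norm_map]
      linarith [hSR a ha])
  set m : J → ℝ≥0∞ := fun i => volume ({x | i ∈ I (g x)} ∩ Metric.ball 0 1) with hm
  have hmeas : ∀ i, MeasurableSet {x | i ∈ I (g x)} := fun i => hgm fun x => i ∈ I x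
  have hlow : c * β ≤ ∑' i : J, ENNReal.ofReal (((1 / 2 : ℝ) ^ i.1.1) ^ s) * m i := by
    calc c * β = ∫⁻ _x in Metric.ball (0 : EuclideanSpace ℝ (Fin n)) 1, c :=
          (setLIntegral_const _ _).symm
      _ ≤ ∫⁻ x in Metric.ball (0 : EuclideanSpace ℝ (Fin n)) 1, ∑' i : J,
            {x | i ∈ I (g x)}.indicator (fun _ => ENNReal.ofReal (((1 / 2 : ℝ) ^ i.1.1) ^ s)) x := by
          refine lintegral_mono fun x => (hIc (g x)).trans ?_
          refine le_trans (le_of_eq ?_) (ENNReal.sum_le_tsum (I (g x)))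
          exact Finset.sum_congr rfl fun i hi =>
            (Set.indicator_of_mem (s := {x | i ∈ I (g x)}) (a := x) hi
              (fun _ => ENNReal.ofReal (((1 / 2 : ℝ) ^ i.1.1) ^ s))).symm
      _ = _ := by
          rw [lintegral_tsum fun i => (measurable_const.indicator (hmeas i)).aemeasurable]
          refine tsum_congr fun i => ?_
          rw [lintegral_indicator_const (hmeas i), Measure.restrict_apply (hmeas i)]
  have hup : ∑' i : J, ENNReal.ofReal (((1 / 2 : ℝ) ^ i.1.1) ^ s) * m i ≤
      c * β / 4 + c * β / 4 := by
    calc ∑' i : J, ENNReal.ofReal (((1 / 2 : ℝ) ^ i.1.1) ^ s) * m i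
        ≤ ∑' i : J, (lam * ENNReal.ofReal (((1 / 2 : ℝ) ^ i.1.1) ^ t) +
            lam⁻¹ * (ENNReal.ofReal (((1 / 2 : ℝ) ^ i.1.1) ^ (2 * s - t)) * m i ^ 2)) := by
          refine ENNReal.tsum_le_tsum fun i => ?_
          have hpos : (0 : ℝ) < (1 / 2) ^ i.1.1 := by positivity
          refine ENNReal.mul_le_add_of_mul_self_eq ?_ ?_ ENNReal.ofReal_ne_top hlamt hlam0
          · rw [← ENNReal.ofReal_mul (by positivity), ← ENNReal.ofReal_mul (by positivity),
              ← Real.rpow_add hpos, ← Real.rpow_add hpos]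
            congr 2; ring
          · rw [Ne, ENNReal.ofReal_eq_zero]; push Not; positivity
      _ = lam * (∑' i : J, ENNReal.ofReal (((1 / 2 : ℝ) ^ i.1.1) ^ t)) + lam⁻¹ *
            ∑' i : J, ENNReal.ofReal (((1 / 2 : ℝ) ^ i.1.1) ^ (2 * s - t)) * m i ^ 2 := by
          rw [ENNReal.tsum_add, ENNReal.tsum_mul_left, ENNReal.tsum_mul_left]
      _ ≤ lam * (c * β / 4 / lam) + lam⁻¹ * (K + 1) := by
          gcongr
          exact hbound.trans le_self_add
      _ = c * β / 4 + c * β / 4 := by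
          rw [ENNReal.mul_div_cancel hlam0 hlamt]
          congr 1
          rw [hlam, ENNReal.inv_div (.inl hqt) (.inl hq0), ENNReal.div_mul_cancel (by simp)
            (ENNReal.add_ne_top.2 ⟨hK, by simp⟩)]
  have hlt : c * β / 4 + c * β / 4 < c * β := by
    have h2 : c * β / 4 + c * β / 4 = c * β / 2 := by
      rw [← two_mul, ← mul_div_assoc, ENNReal.div_eq_div_iff (by norm_num) (by norm_num)
        (by norm_num) (by norm_num)]
      ring
    rw [h2]
    exact ENNReal.half_lt_self hcβ.ne' hcβt
  exact absurd (hlow.trans hup) (not_le.2 hlt)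

/-- Rotated copies about every point of a `k`-dimensional set covered by countably many `k`-flats
missing the origin fill a set of dimension at least `k + 1`. -/
theorem ContainsRotatedCopies.le_dimH {n k : ℕ} {S A : Set (EuclideanSpace ℝ (Fin n))}
    (hA : ContainsRotatedCopies S A) (hS : CoveredByFlatsMissingZero k S) (hne : S.Nonempty)
    (hdim : (k : ℝ≥0∞) ≤ dimH S) : ((k + 1 : ℕ) : ℝ≥0∞) ≤ dimH A := by
  by_contra! hlt
  obtain ⟨t, hAt, htk⟩ := ENNReal.lt_iff_exists_nnreal_btwn.1 hlt
  have ht0 : 0 < (t : ℝ) := by exact_mod_cast (zero_le.trans_lt hAt : (0 : ℝ≥0∞) < t)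
  have htk' : (t : ℝ) < k + 1 := by
    have : t < ((k + 1 : ℕ) : NNReal) := by exact_mod_cast htk
    exact_mod_cast this
  -- For `k > 0` any `s < k` close to `k` works, since `t < k + 1`. For `k = 0` there is no room
  -- below, but `s = 0` is allowed because counting measure does not vanish on a nonempty set.
  have hs : ∃ s : ℝ, 0 ≤ s ∧ (k : ℝ) - 1 < 2 * s - t ∧ Measure.hausdorffMeasure s S ≠ 0 := by
    rcases Nat.eq_zero_or_pos k with rfl | hk
    · refine ⟨0, le_rfl, by push_cast at htk' ⊢; linarith, fun h => ?_⟩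
      obtain ⟨a, ha⟩ := hne
      have := measure_mono_null (Set.singleton_subset_iff.2 ha) h
      rw [Measure.hausdorffMeasure_zero_singleton] at this
      exact one_ne_zero this
    · have hk' : (0 : ℝ) < k := by exact_mod_cast hk
      obtain ⟨s, hs1, hs2⟩ := exists_between (max_lt hk' (by linarith : (t + k - 1) / 2 < (k : ℝ)))
      have hs0 : 0 ≤ s := ((le_max_left _ _).trans_lt hs1).le
      refine ⟨s, hs0, by linarith [(le_max_right _ _).trans_lt hs1], ?_⟩
      have : (s.toNNReal : ℝ≥0∞) < dimH S := by
        refine lt_of_lt_of_le ?_ hdim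
        have : s.toNNReal < (k : NNReal) := by
          rw [Real.toNNReal_lt_iff_lt_coe hs0]; exact_mod_cast hs2
        exact_mod_cast this
      have h := hausdorffMeasure_of_lt_dimH this
      rw [Real.coe_toNNReal _ hs0] at h
      simp [h]
  obtain ⟨s, hs0, hst, hsS⟩ := hs
  obtain ⟨ι, _, L, v, hL, hv0, hvL, hSV⟩ := hS.exists_family
  have hpiece : ∃ i, ∃ R : ℕ, Measure.hausdorffMeasure s
      (S ∩ ({y | y - v i ∈ L i} ∩ Metric.closedBall 0 R)) ≠ 0 := by
    by_contra! h
    refine hsS (measure_mono_null (fun a ha => ?_)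
      (measure_iUnion_null fun i => measure_iUnion_null fun R => h i R))
    obtain ⟨i, hi⟩ := Set.mem_iUnion.1 (hSV ha)
    obtain ⟨R, hR⟩ := exists_nat_ge ‖a‖
    exact Set.mem_iUnion.2 ⟨i, Set.mem_iUnion.2 ⟨R, ha, hi, mem_closedBall_zero_iff.2 hR⟩⟩
  obtain ⟨i, R, hiR⟩ := hpiece
  choose T hT using hA
  refine hausdorffMeasure_ne_zero_of_rotated_copies (hL i) (hv0 i) (hvL i) R.cast_nonneg hs0 ht0 hst
    (fun a ha => ha.2.1) (fun a ha => mem_closedBall_zero_iff.1 ha.2.2) hiR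
    (fun x => specialOrthogonalIsometry (T x)) (fun x a ha => hT x ?_)
    (hausdorffMeasure_of_dimH_lt hAt)
  rw [scaledCopy_rotate]
  exact ⟨a, ha.1, by simp⟩

/-! ### Faces of a cube. -/

theorem OrthonormalBasis.apply_eq_sum {n : ℕ}
    (b : OrthonormalBasis (Fin n) ℝ (EuclideanSpace ℝ (Fin n)))
    (l : StrongDual ℝ (EuclideanSpace ℝ (Fin n))) (x : EuclideanSpace ℝ (Fin n)) :
    l x = ∑ i, l (b i) * inner ℝ (b i) x := by
  conv_lhs => rw [← b.sum_repr' x, map_sum]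
  exact Finset.sum_congr rfl fun i _ => by rw [map_smul, smul_eq_mul, mul_comm]

theorem convex_cube {n : ℕ} (b : OrthonormalBasis (Fin n) ℝ (EuclideanSpace ℝ (Fin n))) (a : ℝ) :
    Convex ℝ (cube b a) := by
  intro x hx y hy s t hs ht hst i
  rw [inner_add_right, inner_smul_right, inner_smul_right]
  calc |s * inner ℝ (b i) x + t * inner ℝ (b i) y|
      ≤ s * |inner ℝ (b i) x| + t * |inner ℝ (b i) y| := by
        refine (abs_add_le _ _).trans_eq ?_
        rw [abs_mul, abs_mul, abs_of_nonneg hs, abs_of_nonneg ht]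
    _ ≤ s * a + t * a := by gcongr <;> [exact hx i; exact hy i]
    _ = a := by rw [← add_mul, hst, one_mul]

theorem inner_add_smul_basis {n : ℕ}
    (b : OrthonormalBasis (Fin n) ℝ (EuclideanSpace ℝ (Fin n))) (x : EuclideanSpace ℝ (Fin n))
    (t : ℝ) (i j : Fin n) :
    inner ℝ (b j) (x + t • b i) = inner ℝ (b j) x + if j = i then t else 0 := by
  rw [inner_add_right, inner_smul_right, b.inner_eq_ite]
  simp

/-- The faces of a cube are given by the signs of the coordinates of the exposing functional. -/
theorem setOf_isMax_cube_eq {n : ℕ} (b : OrthonormalBasis (Fin n) ℝ (EuclideanSpace ℝ (Fin n)))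
    {a : ℝ} (ha : 0 < a) (l : StrongDual ℝ (EuclideanSpace ℝ (Fin n))) :
    {x ∈ cube b a | ∀ y ∈ cube b a, l y ≤ l x} =
      {x ∈ cube b a | ∀ i, (SignType.sign (l (b i)) = 1 → inner ℝ (b i) x = a) ∧
        (SignType.sign (l (b i)) = -1 → inner ℝ (b i) x = -a)} := by
  ext x
  refine and_congr_right fun hx => ⟨fun h i => ?_, fun h y hy => ?_⟩
  · have hmem : ∀ t : ℝ, |t| ≤ a → x + (t - inner ℝ (b i) x) • b i ∈ cube b a := by
      intro t ht j
      rw [inner_add_smul_basis]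
      split_ifs with hij
      · rw [hij]; simpa using ht
      · simpa using hx j
    have hle : ∀ t : ℝ, |t| ≤ a → (t - inner ℝ (b i) x) * l (b i) ≤ 0 := by
      intro t ht
      have := h _ (hmem t ht)
      rw [map_add, map_smul, smul_eq_mul] at this
      linarith
    have hxi := abs_le.1 (hx i)
    refine ⟨fun hs => ?_, fun hs => ?_⟩
    · have hpos := sign_eq_one_iff.1 hs
      have := hle a (abs_of_pos ha).le
      nlinarith
    · have hneg := sign_eq_neg_one_iff.1 hs
      have := hle (-a) (by rw [abs_neg, abs_of_pos ha])
      nlinarith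
  · rw [b.apply_eq_sum l y, b.apply_eq_sum l x]
    refine Finset.sum_le_sum fun i _ => ?_
    have hyi := abs_le.1 (hy i)
    rcases lt_trichotomy (l (b i)) 0 with h0 | h0 | h0
    · rw [(h i).2 (sign_eq_neg_one_iff.2 h0)]; nlinarith
    · simp [h0]
    · rw [(h i).1 (sign_eq_one_iff.2 h0)]; nlinarith

/-- A face depends only on the signs of its exposing functional on the basis, and there are finitely
many sign vectors. -/
theorem finite_setOf_face_cube {n : ℕ}
    (b : OrthonormalBasis (Fin n) ℝ (EuclideanSpace ℝ (Fin n))) {a : ℝ} (ha : 0 < a) (k : ℕ) :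
    {F | F.Nonempty ∧ IsExposed ℝ (cube b a) F ∧
      Module.finrank ℝ (vectorSpan ℝ F) = k}.Finite := by
  refine (Set.finite_range fun σ : Fin n → SignType => {x ∈ cube b a | ∀ i,
    (σ i = 1 → inner ℝ (b i) x = a) ∧ (σ i = -1 → inner ℝ (b i) x = -a)}).subset ?_
  rintro F ⟨hne, hF, -⟩
  obtain ⟨l, rfl⟩ := hF hne
  exact ⟨fun i => SignType.sign (l (b i)), (setOf_isMax_cube_eq b ha l).symm⟩

theorem vectorSpan_cube {n : ℕ} (b : OrthonormalBasis (Fin n) ℝ (EuclideanSpace ℝ (Fin n)))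
    {a : ℝ} (ha : 0 < a) : vectorSpan ℝ (cube b a) = ⊤ := by
  rw [eq_top_iff, ← b.toBasis.span_eq, Submodule.span_le]
  rintro _ ⟨i, rfl⟩
  have h0 : (0 : EuclideanSpace ℝ (Fin n)) ∈ cube b a := fun j => by simpa using ha.le
  have h1 : a • b i ∈ cube b a := fun j => by
    have := inner_add_smul_basis b 0 a i j
    rw [zero_add, inner_zero_right, zero_add] at this
    rw [this]
    split_ifs
    · exact (abs_of_pos ha).le
    · simpa using ha.le
  have h2 := vsub_mem_vectorSpan ℝ h1 h0
  rw [vsub_eq_sub, sub_zero] at h2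
  have h3 := (vectorSpan ℝ (cube b a)).smul_mem a⁻¹ h2
  rw [smul_smul, inv_mul_cancel₀ ha.ne', one_smul] at h3
  simpa using h3

/-- The exposing functional is constant on the affine span of the face. If the span contained `0`,
its maximum over the symmetric cube would be `0`, so it would vanish on the cube, and the face would
be the whole cube, of dimension `n > k`. -/
theorem zero_notMem_affineSpan_face_cube {n k : ℕ} (hk : k < n)
    (b : OrthonormalBasis (Fin n) ℝ (EuclideanSpace ℝ (Fin n))) {a : ℝ} (ha : 0 < a)
    {F : Set (EuclideanSpace ℝ (Fin n))} (hne : F.Nonempty) (hF : IsExposed ℝ (cube b a) F)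
    (hfin : Module.finrank ℝ (vectorSpan ℝ F) = k) :
    (0 : EuclideanSpace ℝ (Fin n)) ∉ affineSpan ℝ F := by
  intro h0
  obtain ⟨l, hl⟩ := hF hne
  obtain ⟨x₀, hx₀⟩ := hne
  have hx₀' := hx₀
  rw [hl] at hx₀'
  have hconst : ∀ y ∈ affineSpan ℝ F, l y = l x₀ := by
    intro y hy
    refine affineSpan_induction (p := fun y => l y = l x₀) hy (fun z hz => ?_)
      fun c u v w hu hv hw => ?_
    · rw [hl] at hz
      exact le_antisymm (hx₀'.2 z hz.1) (hz.2 x₀ hx₀'.1)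
    · simp [hu, hv, hw]
  have hM : l x₀ = 0 := by rw [← hconst 0 h0, map_zero]
  have hneg : ∀ y ∈ cube b a, -y ∈ cube b a := fun y hy i => by
    rw [inner_neg_right, abs_neg]; exact hy i
  have hzero : ∀ y ∈ cube b a, l y = 0 := fun y hy => by
    have h1 := hx₀'.2 y hy
    have h2 := hx₀'.2 (-y) (hneg y hy)
    rw [map_neg] at h2
    linarith
  have hFP : F = cube b a := by
    rw [hl]
    exact Set.Subset.antisymm (fun x hx => hx.1) fun x hx =>
      ⟨hx, fun y hy => by rw [hzero y hy, hzero x hx]⟩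
  rw [hFP, vectorSpan_cube b ha, finrank_top, finrank_euclideanSpace_fin] at hfin
  omega

theorem exists_face_cube {n k : ℕ} (hk : k < n)
    (b : OrthonormalBasis (Fin n) ℝ (EuclideanSpace ℝ (Fin n))) {a : ℝ} (ha : 0 < a) :
    ∃ F : Set (EuclideanSpace ℝ (Fin n)), F.Nonempty ∧ IsExposed ℝ (cube b a) F ∧
      Module.finrank ℝ (vectorSpan ℝ F) = k := by
  classical
  -- The sum of the coordinates with index at least `k` exposes the face where these equal `a` and
  -- the first `k` coordinates stay free.
  let l : StrongDual ℝ (EuclideanSpace ℝ (Fin n)) :=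
    ∑ j ∈ Finset.univ.filter (fun j : Fin n => k ≤ (j : ℕ)), innerSL ℝ (b j)
  have hl : ∀ i, l (b i) = if k ≤ (i : ℕ) then 1 else 0 := fun i => by
    simp [l, b.inner_eq_ite, sum_apply]
  let F := {x ∈ cube b a | ∀ y ∈ cube b a, l y ≤ l x}
  have hF : F = {x ∈ cube b a | ∀ i : Fin n, k ≤ (i : ℕ) → inner ℝ (b i) x = a} := by
    rw [show F = _ from setOf_isMax_cube_eq b ha l]
    ext x
    refine and_congr_right fun _ => forall_congr' fun i => ?_
    rw [hl]
    split_ifs with h <;> simp [h]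
  let x₀ : EuclideanSpace ℝ (Fin n) := ∑ j : Fin n, (if k ≤ (j : ℕ) then a else 0) • b j
  have hx₀ : ∀ i, inner ℝ (b i) x₀ = if k ≤ (i : ℕ) then a else 0 := fun i =>
    b.orthonormal.inner_right_fintype (fun j : Fin n => if k ≤ (j : ℕ) then a else 0) i
  have hx₀F : x₀ ∈ F := by
    rw [hF]
    refine ⟨fun i => ?_, fun i hi => by rw [hx₀, if_pos hi]⟩
    rw [hx₀]
    split_ifs
    · exact (abs_of_pos ha).le
    · simpa using ha.le
  refine ⟨F, ⟨x₀, hx₀F⟩, fun _ => ⟨l, rfl⟩, ?_⟩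
  have hspan : vectorSpan ℝ F = Submodule.span ℝ (Set.range fun i : Fin k => b (i.castLE hk.le)) := by
    refine le_antisymm ?_ (Submodule.span_le.2 ?_)
    · rw [vectorSpan, Submodule.span_le]
      rintro _ ⟨x, hx, y, hy, rfl⟩
      rw [hF] at hx hy
      change x - y ∈ Submodule.span ℝ _
      rw [← b.sum_repr' (x - y)]
      refine Submodule.sum_mem _ fun i _ => ?_
      rcases lt_or_ge (i : ℕ) k with hi | hi
      · exact Submodule.smul_mem _ _ (Submodule.subset_span ⟨⟨i, hi⟩, rfl⟩)
      · simp [inner_sub_right, hx.2 i hi, hy.2 i hi]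
    · rintro _ ⟨i, rfl⟩
      have h1 : x₀ + a • b (i.castLE hk.le) ∈ F := by
        rw [hF]
        refine ⟨fun j => ?_, fun j hj => ?_⟩
        · rw [inner_add_smul_basis, hx₀]
          split_ifs with h2 h3
          · have := congrArg Fin.val h3
            have := i.2
            simp at *
            omega
          · simpa using (abs_of_pos ha).le
          · simpa using (abs_of_pos ha).le
          · simpa using ha.le
        · rw [inner_add_smul_basis, hx₀, if_pos hj, if_neg, add_zero]
          rintro rfl
          have := i.2
          simp at hj
          omega
      have h2 := vsub_mem_vectorSpan ℝ h1 hx₀F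
      rw [vsub_eq_sub, add_sub_cancel_left] at h2
      have h3 := (vectorSpan ℝ F).smul_mem a⁻¹ h2
      rwa [smul_smul, inv_mul_cancel₀ ha.ne', one_smul] at h3
  rw [hspan, finrank_span_eq_card, Fintype.card_fin]
  exact b.orthonormal.linearIndependent.comp _ (Fin.castLE_injective hk.le)

theorem IsCubeSkeleton.nonempty_dimH_eq_coveredByFlats {n k : ℕ} (hk : k < n)
    {S : Set (EuclideanSpace ℝ (Fin n))} (hS : IsCubeSkeleton k S) :
    S.Nonempty ∧ dimH S = k ∧ CoveredByFlatsMissingZero k S := by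
  obtain ⟨b, a, ha, rfl⟩ := hS
  have hfin := (finite_setOf_face_cube b ha k).countable
  obtain ⟨F₀, hF₀⟩ := exists_face_cube hk b ha
  refine ⟨?_, ?_, ?_⟩
  · obtain ⟨x, hx⟩ := hF₀.1
    exact ⟨x, F₀, hF₀, hx⟩
  · have hdim : ∀ F ∈ {F | F.Nonempty ∧ IsExposed ℝ (cube b a) F ∧
        Module.finrank ℝ (vectorSpan ℝ F) = k}, dimH F = k := by
      rintro F ⟨h1, h2, h3⟩
      rw [Real.Convex.dimH_eq_finrank_vectorSpan (h2.convex (convex_cube b a)) h1, h3]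
    refine le_antisymm ?_ ?_
    · rw [skeleton, dimH_sUnion hfin]
      exact iSup₂_le fun F hF => (hdim F hF).le
    · rw [← hdim F₀ hF₀]
      exact dimH_mono (Set.subset_sUnion_of_mem hF₀)
  · refine ⟨affineSpan ℝ '' {F | F.Nonempty ∧ IsExposed ℝ (cube b a) F ∧
        Module.finrank ℝ (vectorSpan ℝ F) = k}, hfin.image _, ?_, ?_⟩
    · rintro _ ⟨F, ⟨h1, h2, h3⟩, rfl⟩
      exact ⟨(affineSpan_nonempty ℝ).2 h1, by rw [direction_affineSpan, h3],
        zero_notMem_affineSpan_face_cube hk b ha h1 h2 h3⟩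
    · rintro x ⟨F, hF, hx⟩
      exact Set.mem_iUnion₂.2 ⟨_, ⟨F, hF, rfl⟩, subset_affineSpan ℝ F hx⟩

/-! ### The four minima. -/

theorem corollary1p1 (n k : ℕ) (hkn : k < n) (S : Set (EuclideanSpace ℝ (Fin n)))
    (hS : IsCubeSkeleton k S ∨
      (S.Nonempty ∧ dimH S = (k : ℝ≥0∞) ∧ CoveredByFlatsMissingZero k S)) :
    IsLeast {d : ℝ≥0∞ | ∃ A : Set (EuclideanSpace ℝ (Fin n)),
        MeasurableSet A ∧ ContainsScaledCopies S A ∧ dimH A = d} ((n - 1 : ℕ) : ℝ≥0∞) ∧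
    IsLeast {d : ℝ≥0∞ | ∃ A : Set (EuclideanSpace ℝ (Fin n)),
        MeasurableSet A ∧ ContainsScaledRotatedCopies S A ∧ dimH A = d} (k : ℝ≥0∞) ∧
    IsLeast {d : ℝ≥0∞ | ∃ A : Set (EuclideanSpace ℝ (Fin n)),
        MeasurableSet A ∧ ContainsRotatedCopies S A ∧ dimH A = d} ((k + 1 : ℕ) : ℝ≥0∞) ∧
    IsLeast {d : ℝ≥0∞ | ∃ A : Set (EuclideanSpace ℝ (Fin n)),
        MeasurableSet A ∧ ContainsRotatedCopiesOfEverySize S A ∧ dimH A = d}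
      ((k + 1 : ℕ) : ℝ≥0∞) := by
  obtain ⟨⟨s, hs⟩, hdim, hcov⟩ : S.Nonempty ∧ dimH S = (k : ℝ≥0∞) ∧
      CoveredByFlatsMissingZero k S :=
    hS.elim (fun h => h.nonempty_dimH_eq_coveredByFlats hkn) id
  have hs0 : s ≠ 0 := fun h => hcov.zero_notMem (h ▸ hs)
  have hone : ∀ A, ContainsRotatedCopiesOfEverySize S A → ContainsRotatedCopies S A :=
    fun A hA x => hA x 1 one_pos
  have hrot : ∀ A, ContainsRotatedCopies S A → ((k + 1 : ℕ) : ℝ≥0∞) ≤ dimH A :=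
    fun A hA => hA.le_dimH hcov ⟨s, hs⟩ hdim.ge
  have hscrot : ∀ A, ContainsScaledRotatedCopies S A → (k : ℝ≥0∞) ≤ dimH A := fun A hA => by
    obtain ⟨r, hr, T, hT⟩ := hA 0
    rw [← hdim]
    exact (dimH_le_dimH_scaledCopy_rotate 0 hr T S).trans (dimH_mono hT)
  obtain ⟨A₁, hm₁, hd₁, h₁⟩ := hcov.exists_containsScaledCopies
  obtain ⟨A₂, hm₂, hd₂, h₂⟩ := hcov.exists_containsScaledRotatedCopies
  obtain ⟨A₃, hm₃, hd₃, h₃⟩ := hcov.exists_containsRotatedCopiesOfEverySize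
  refine ⟨⟨⟨A₁, hm₁, h₁, hd₁.antisymm (h₁.le_dimH hs hs0)⟩, ?_⟩,
    ⟨⟨A₂, hm₂, h₂, hd₂.antisymm (hscrot _ h₂)⟩, ?_⟩,
    ⟨⟨A₃, hm₃, hone _ h₃, hd₃.antisymm (hrot _ (hone _ h₃))⟩, ?_⟩,
    ⟨⟨A₃, hm₃, h₃, hd₃.antisymm (hrot _ (hone _ h₃))⟩, ?_⟩⟩
  · rintro _ ⟨A, -, hA, rfl⟩; exact hA.le_dimH hs hs0
  · rintro _ ⟨A, -, hA, rfl⟩; exact hscrot A hA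
  · rintro _ ⟨A, -, hA, rfl⟩; exact hrot A hA
  · rintro _ ⟨A, -, hA, rfl⟩; exact hrot A (hone A hA)
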